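/- **Setting.** Let $U$ be a compact metric space, let $f:\mathbb R^m\times U\to\mathbb R^m$ be continuous and Lipschitz in $y$ uniformly in $u\in U$, and let $k:\mathbb R^m\times U\to\mathbb R$ be continuous. A control is a measurable function $u:[0,\infty)\to U$, and $y(\cdot,y_0,u)$ denotes the solution of $y'(t)=f(y(t),u(t))$, $y(0)=y_0$. Let $Y\subset\mathbb R^m$ be a non-empty compact set equal to the closure of its interior. For $Z\subset\mathbb R^m$ let $\mathcal U_T^Z(y_0)$ (respectively $\mathcal U^Z(y_0)$) be the set of controls with $y(t,y_0,u)\in Z$ for all $t\in[0,T]$ (respectively for all $t\ge 0$); $Z$ is called viable if $\mathcal U^Z(y_0)\ne\emptyset$ for all $y_0\in Z$. Assume that $Y$ is viable. For $T,\lambda>0$ put $$V_T^Z(y_0)=\frac1T\inf_{u\in\mathcal U_T^Z(y_0)}\int_0^Tk(y(t,y_0,u),u(t))\,dt,\qquad h_\lambda^Z(y_0)=\lambda\inf_{u\in\mathcal U^Z(y_0)}\int_0^\infty e^{-\lambda t}k(y(t,y_0,u),u(t))\,dt,$$ and write $V_T=V_T^Y$, $h_\lambda=h_\lambda^Y$,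 $Y^\delta=Y+\delta\bar B$ ($\bar B$ the closed Euclidean unit ball), $V_T^\delta=V_T^{Y^\delta}$, $h_\lambda^\delta=h_\lambda^{Y^\delta}$. Let $\Gamma_T$ be the set of all occupational measures $Q\mapsto\frac1T\int_0^T1_Q(y(t,y_0,u),u(t))\,dt$ on $Y\times U$ with $y_0\in Y$, $u\in\mathcal U_T^Y(y_0)$, and let $\Theta^\lambda$ be the set of all discounted occupational measures $Q\mapsto\lambda\int_0^\infty e^{-\lambda t}1_Q(y(t,y_0,u),u(t))\,dt$ with $y_0\in Y$, $u\in\mathcal U^Y(y_0)$. Let $\mathcal P(Y\times U)$ and $\mathcal M_+(Y\times U)$ be the sets of Borel probability measures and of finite non-negative Borel measures on $Y\times U$, and let $$W=\Big\{\gamma\in\mathcal P(Y\times U):\ \int_{Y\times U}\nabla\phi(y)f(y,u)\,\gamma(dy,du)=0\ \ \forall\,\phi\in C^1(\mathbb R^m)\Big\}.$$ Let $(q_j)_{j\ge1}$ be a sequence of Lipschitz functions that lies in, and is uniformly dense in, the unit ball of $C(Y\times U)$; let $\rho(\gamma',\gamma'')=\sum_{j\ge1}2^{-j}\big|\int q_j\,d\gamma'-\int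 q_j\,d\gamma''\big|$ on $\mathcal P(Y\times U)$, and let $\rho_H$ be the corresponding Hausdorff distance between subsets of $\mathcal P(Y\times U)$. For $y_0\in Y$ let $$k^*(y_0)=\inf_{(\gamma,\xi)\in\Omega(y_0)}\int_{Y\times U}k\,d\gamma\in(-\infty,+\infty]\qquad(\inf\emptyset=+\infty),$$ where $\Omega(y_0)$ is the set of pairs $(\gamma,\xi)\in W\times\mathcal M_+(Y\times U)$ with $$\int_{Y\times U}(\phi(y_0)-\phi(y))\,\gamma(dy,du)+\int_{Y\times U}\nabla\phi(y)f(y,u)\,\xi(dy,du)=0\quad\forall\,\phi\in C^1(\mathbb R^m).$$ **Assumptions.** For some $\delta_0>0$: * (A1) $Y^\delta$ is viable for all $\delta\in(0,\delta_0)$. * (A2) For all $\delta\in(0,\delta_0)$ and $T>0$, $V_T^\delta$ is Lipschitz on $Y^\delta$. * (A3) For all $\delta\in(0,\delta_0)$ and $\lambda>0$, $h_\lambda^\delta$ is Lipschitz on $Y^\delta$. * (A4) $\lim_{T\to\infty,\ \delta\downarrow0}|V_T(y_0)-V_T^\delta(y_0)|=0$ (joint limit) for every $y_0\in Y$. * (A5)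 $\lim_{T\to\infty}\rho_H(\mathrm{co}\,\Gamma_T,W)=0$, where $\mathrm{co}$ is the convex hull. * (A6) $\lim_{\lambda\downarrow0,\ \delta\downarrow0}|h_\lambda(y_0)-h_\lambda^\delta(y_0)|=0$ (joint limit) for every $y_0\in Y$. * (A7) $\lim_{\lambda\downarrow0}\rho_H(\mathrm{co}\,\Theta^\lambda,W)=0$. **Theorem.** (a) Under (A1), (A2), (A4) and (A5), $$\limsup_{T\to\infty}V_T(y_0)\le k^*(y_0)\qquad\text{for all }y_0\in Y.$$ (b) Under (A1), (A3), (A6) and (A7), $$\limsup_{\lambda\downarrow0}h_\lambda(y_0)\le k^*(y_0)\qquad\text{for all }y_0\in Y.$$ -/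

import Mathlib

open MeasureTheory Filter Topology
open scoped ENNReal NNReal Pointwise

noncomputable section

namespace LongRunControl

variable {m : ℕ} {U : Type*} [MetricSpace U] [MeasurableSpace U]

/-- The state space `ℝ^m` with its Euclidean norm. -/
abbrev State (m : ℕ) : Type := EuclideanSpace ℝ (Fin m)

/-- `(y, u)` is a control process started at `y₀`: the control `u` is measurable and `y` is the
(Caratheodory) solution on `[0, ∞)` of `y' = f(y, u)`, `y(0) = y₀`, written in integral form.
Only the values of `u` and `y` at times `t ≥ 0` matter. -/
def IsProcess (f : State m → U → State m) (y₀ : State m) (u : ℝ → U) (y : ℝ → State m) : Prop :=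
  Measurable u ∧ ContinuousOn y (Set.Ici 0) ∧
    ∀ t : ℝ, 0 ≤ t → y t = y₀ + ∫ s in (0 : ℝ)..t, f (y s) (u s)

/-- A process from `y₀` whose trajectory stays in `Y` on the time interval `[0, T]`. -/
def IsAdmissibleUpTo (f : State m → U → State m) (Y : Set (State m)) (T : ℝ) (y₀ : State m)
    (u : ℝ → U) (y : ℝ → State m) : Prop :=
  IsProcess f y₀ u y ∧ ∀ t ∈ Set.Icc 0 T, y t ∈ Y

/-- A process from `y₀` whose trajectory stays in `Y` on `[0, ∞)`. -/
def IsAdmissible (f : State m → U → State m) (Y : Set (State m)) (y₀ : State m)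
    (u : ℝ → U) (y : ℝ → State m) : Prop :=
  IsProcess f y₀ u y ∧ ∀ t ∈ Set.Ici (0 : ℝ), y t ∈ Y

/-- The system is viable on `Y`: an admissible control exists for every initial state in `Y`. -/
def IsViable (f : State m → U → State m) (Y : Set (State m)) : Prop :=
  ∀ y₀ ∈ Y, ∃ u y, IsAdmissible f Y y₀ u y

/-- The closed `δ`-neighbourhood `Y^δ = Y + δ B̄`. -/
def enlarge (Y : Set (State m)) (δ : ℝ) : Set (State m) := Y + Metric.closedBall 0 δ

/-- The optimal value `V_T(y₀)` of the time-averaged problem with state constraint `Y`. -/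
def cesaroValue (f : State m → U → State m) (k : State m → U → ℝ) (Y : Set (State m))
    (T : ℝ) (y₀ : State m) : ℝ :=
  (1 / T) * sInf {c : ℝ | ∃ u y, IsAdmissibleUpTo f Y T y₀ u y ∧
    c = ∫ t in (0 : ℝ)..T, k (y t) (u t)}

/-- The optimal value `h_lam(y₀)` of the discounted problem with state constraint `Y`. -/
def abelValue (f : State m → U → State m) (k : State m → U → ℝ) (Y : Set (State m))
    (lam : ℝ) (y₀ : State m) : ℝ :=
  lam * sInf {c : ℝ | ∃ u y, IsAdmissible f Y y₀ u y ∧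
    c = ∫ t in Set.Ioi (0 : ℝ), Real.exp (-lam * t) * k (y t) (u t)}

/-- The inclusion of `Y × U` into `ℝ^m × U`. -/
def incl (Y : Set (State m)) (p : Y × U) : State m × U := (p.1, p.2)

/-- `Γ_T`: the occupational measures on `[0, T]` of all processes that start in `Y` and stay in `Y`
on `[0, T]`. (The Borel subsets of `Y × U` are the traces of the Borel sets `Q` of `ℝ^m × U`.) -/
def occupationalMeasures (f : State m → U → State m) (Y : Set (State m)) (T : ℝ) :
    Set (ProbabilityMeasure (Y × U)) :=
  {γ | ∃ y₀ ∈ Y, ∃ u y, IsAdmissibleUpTo f Y T y₀ u y ∧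
    ∀ Q : Set (State m × U), MeasurableSet Q →
      (γ : Measure (Y × U)) (incl Y ⁻¹' Q) =
        ENNReal.ofReal (1 / T) * ∫⁻ t in Set.Icc 0 T, Q.indicator 1 (y t, u t)}

/-- `Θ^lam`: the discounted occupational measures of all processes that start and stay in `Y`. -/
def discountedOccupationalMeasures (f : State m → U → State m) (Y : Set (State m)) (lam : ℝ) :
    Set (ProbabilityMeasure (Y × U)) :=
  {γ | ∃ y₀ ∈ Y, ∃ u y, IsAdmissible f Y y₀ u y ∧
    ∀ Q : Set (State m × U), MeasurableSet Q →
      (γ : Measure (Y × U)) (incl Y ⁻¹' Q) =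
        ENNReal.ofReal lam * ∫⁻ t in Set.Ici (0 : ℝ),
          ENNReal.ofReal (Real.exp (-lam * t)) * Q.indicator 1 (y t, u t)}

/-- The convex hull of a set of probability measures. -/
def coHull {X : Type*} [MeasurableSpace X] (S : Set (ProbabilityMeasure X)) :
    Set (ProbabilityMeasure X) :=
  {γ | γ.toFiniteMeasure ∈ convexHull ℝ≥0 (ProbabilityMeasure.toFiniteMeasure '' S)}

/-- `q` is a sequence of Lipschitz functions which lies in, and is uniformly dense in, the closed
unit ball of the space of continuous functions on the (compact) space `X`. -/
def IsLipschitzDenseInUnitBall {X : Type*} [MetricSpace X] (q : ℕ → X → ℝ) : Prop :=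
  (∀ j, ∃ L : ℝ≥0, LipschitzWith L (q j)) ∧ (∀ j x, |q j x| ≤ 1) ∧
    ∀ g : X → ℝ, Continuous g → (∀ x, |g x| ≤ 1) → ∀ ε > 0, ∃ j, ∀ x, |q j x - g x| < ε

/-- The distance `ρ(γ', γ'') = ∑_{j ≥ 1} 2^{-j} |∫ q_j dγ' - ∫ q_j dγ''|`; the sequence is indexed
from `0` here. -/
def rho {X : Type*} [MeasurableSpace X] (q : ℕ → X → ℝ) (γ₁ γ₂ : ProbabilityMeasure X) : ℝ :=
  ∑' j : ℕ, (1 / 2 : ℝ) ^ (j + 1) *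
    |(∫ x, q j x ∂(γ₁ : Measure X)) - ∫ x, q j x ∂(γ₂ : Measure X)|

/-- The Hausdorff distance between two sets of probability measures induced by `rho`. -/
def rhoHausdorff {X : Type*} [MeasurableSpace X] (q : ℕ → X → ℝ)
    (A B : Set (ProbabilityMeasure X)) : ℝ≥0∞ :=
  max (⨆ γ ∈ A, ⨅ γ' ∈ B, ENNReal.ofReal (rho q γ γ'))
    (⨆ γ ∈ B, ⨅ γ' ∈ A, ENNReal.ofReal (rho q γ γ'))

/-- The set `W` of probability measures `γ` on `Y × U` with `∫ ∇φ(y) f(y,u) γ(dy,du) = 0` for all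
`C^1` functions `φ` on `ℝ^m`. -/
def invariantMeasures (f : State m → U → State m) (Y : Set (State m)) :
    Set (ProbabilityMeasure (Y × U)) :=
  {γ | ∀ φ : State m → ℝ, ContDiff ℝ 1 φ →
    ∫ p, fderiv ℝ φ (p.1 : State m) (f p.1 p.2) ∂(γ : Measure (Y × U)) = 0}

/-- The feasible set `Ω(y₀)` of the infinite-dimensional linear program. -/
def feasibleSet (f : State m → U → State m) (Y : Set (State m)) (y₀ : State m) :
    Set (ProbabilityMeasure (Y × U) × FiniteMeasure (Y × U)) :=
  {π | π.1 ∈ invariantMeasures f Y ∧ ∀ φ : State m → ℝ, ContDiff ℝ 1 φ →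
    (∫ p, (φ y₀ - φ (p.1 : State m)) ∂(π.1 : Measure (Y × U))) +
      ∫ p, fderiv ℝ φ (p.1 : State m) (f p.1 p.2) ∂(π.2 : Measure (Y × U)) = 0}

/-- The optimal value `k*(y₀)` of the infinite-dimensional linear program
(`+∞` when the program is infeasible). -/
def lpValue (f : State m → U → State m) (k : State m → U → ℝ) (Y : Set (State m))
    (y₀ : State m) : EReal :=
  ⨅ π ∈ feasibleSet f Y y₀, ((∫ p, k (p.1 : State m) p.2 ∂(π.1 : Measure (Y × U)) : ℝ) : EReal)

end LongRunControl

end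

/-! The argument is weak duality for the linear program, with the value function of the relaxed
problem on `Y^δ` as dual test function. Let `V` be a Lipschitz extension to the whole space of
`V_T^δ` or `h_λ^δ`. Following a constant control for a short time before switching to a nearly
optimal process gives `∇V·f + g ≥ 0` in an integrated sense near `Y`, where `g = 2M/T` for time
averages, `g = λ(k - V)` for discounted ones, and `M` bounds `|k|`. The enlargement `Y^δ` leaves
room around `Y` to mollify: `V` is a uniform limit of `C^1` functions `φ` with `∇φ·f + g ≥ -ε` on
`Y` (`exists_smooth_subsolution`). Inserting `φ` in the constraint that defines `Ω(y₀)` yields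
`V(y₀) - ∫ V dγ ≤ ∫ g dξ`, and the right side is `O(1/T)` or `O(λ)` for fixed `ξ`, uniformly in `δ`.

It remains to see that `∫ V dγ ≤ ∫ k dγ`. In the discounted case, testing the invariance of `γ` with
`φ` gives `λ ∫ (k - V) dγ ≥ 0`. In the Cesàro case `g` carries no such information. There `γ` is
approximated by convex combinations of occupational measures over long horizons, and along one
process the mean of the optimal `S`-averages exceeds the mean cost by at most `3MS/T`
(`integral_cesaroValue_along_le`). The resulting bounds on `V_T^δ(y₀)` and `h_λ^δ(y₀)` are uniform
in `δ`, so the joint limits in (A4) and (A6) carry them over to `V_T(y₀)` and `h_λ(y₀)`. -/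

namespace LongRunControl

/-! ### Trajectories: shifting, concatenation, short-time existence -/

section Processes

set_option linter.unusedSectionVars false

variable {m : ℕ} {U : Type*} [MetricSpace U] [CompactSpace U] [MeasurableSpace U] [BorelSpace U]
  {f : State m → U → State m} {G : Type*} [NormedAddCommGroup G]

theorem exists_norm_le_of_isCompact {F : State m → U → G} (hF : Continuous (Function.uncurry F))
    {K : Set (State m)} (hK : IsCompact K) : ∃ C : ℝ, 0 < C ∧ ∀ z ∈ K, ∀ a, ‖F z a‖ ≤ C := by
  obtain ⟨C, hC⟩ := (hK.prod (isCompact_univ (X := U))).exists_bound_of_continuousOn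
    hF.continuousOn
  exact ⟨max C 1, by positivity, fun z hz a => (hC (z, a) ⟨hz, trivial⟩).trans (le_max_left _ _)⟩

theorem aestronglyMeasurable_along {F : State m → U → G} (hF : Continuous (Function.uncurry F))
    {u : ℝ → U} {y : ℝ → State m} (hu : Measurable u) (hy : ContinuousOn y (Set.Ici 0)) :
    AEStronglyMeasurable (fun s => F (y s) (u s)) (volume.restrict (Set.Ici 0)) := by
  have : SecondCountableTopology U := EMetric.secondCountable_of_sigmaCompact U
  have h1 : AEMeasurable y (volume.restrict (Set.Ici (0 : ℝ))) := hy.aemeasurable measurableSet_Ici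
  exact hF.comp_aestronglyMeasurable (h1.prodMk hu.aemeasurable).aestronglyMeasurable

theorem intervalIntegrable_along {F : State m → U → G} (hF : Continuous (Function.uncurry F))
    {u : ℝ → U} {y : ℝ → State m} (hu : Measurable u) (hy : ContinuousOn y (Set.Ici 0))
    {a b : ℝ} (ha : 0 ≤ a) (hb : 0 ≤ b) :
    IntervalIntegrable (fun s => F (y s) (u s)) volume a b := by
  have hsub : Set.uIcc a b ⊆ Set.Ici 0 := fun s hs => (le_inf ha hb).trans hs.1
  obtain ⟨C, -, hC⟩ := exists_norm_le_of_isCompact hF (isCompact_uIcc.image_of_continuousOn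
    (hy.mono hsub))
  have hsub' : Set.uIoc a b ⊆ Set.Ici 0 := Set.uIoc_subset_uIcc.trans hsub
  rw [intervalIntegrable_iff]
  have : IsFiniteMeasure (volume.restrict (Set.uIoc a b)) := ⟨by simp⟩
  refine Integrable.of_bound (AEStronglyMeasurable.mono_measure (aestronglyMeasurable_along hF hu hy)
    (Measure.restrict_mono hsub' (le_refl volume))) C ?_
  filter_upwards [ae_restrict_mem measurableSet_uIoc] with s hs
  exact hC _ ⟨s, Set.uIoc_subset_uIcc hs, rfl⟩ _

theorem IsProcess.shift (hf : Continuous (Function.uncurry f)) {y₀ : State m} {u : ℝ → U}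
    {y : ℝ → State m} (h : IsProcess f y₀ u y) {t : ℝ} (ht : 0 ≤ t) :
    IsProcess f (y t) (fun s => u (s + t)) (fun s => y (s + t)) := by
  obtain ⟨hu, hy, hint⟩ := h
  refine ⟨hu.comp (measurable_id.add_const t), ?_, fun s hs => ?_⟩
  · refine hy.comp (by fun_prop) fun s hs => ?_
    simp only [Set.mem_Ici] at hs ⊢
    linarith
  · have := intervalIntegral.integral_comp_add_right (a := 0) (b := s)
      (fun r => f (y r) (u r)) t
    simp only [this]
    rw [hint _ (add_nonneg hs ht), hint t ht, add_assoc, zero_add,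
      intervalIntegral.integral_add_adjacent_intervals]
    · exact intervalIntegrable_along hf hu hy le_rfl ht
    · exact intervalIntegrable_along hf hu hy ht (by linarith)

/-- Follow a curve with constant control on `[0, t]`, then switch. -/
theorem IsProcess.concat {y₁ y₂ : ℝ → State m} {a : U} {u₂ : ℝ → U} {x : State m} {t : ℝ}
    (hf : Continuous (Function.uncurry f)) (ht : 0 ≤ t)
    (hc : Continuous y₁) (h₁ : ∀ s ∈ Set.Icc 0 t, y₁ s = x + ∫ r in (0 : ℝ)..s, f (y₁ r) a)
    (h₂ : IsProcess f (y₁ t) u₂ y₂) :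
    IsProcess f x (fun s => if s ≤ t then a else u₂ (s - t))
      (fun s => if s ≤ t then y₁ s else y₂ (s - t)) := by
  obtain ⟨hu, hy, hint⟩ := h₂
  have h0 : y₂ 0 = y₁ t := by simpa using hint 0 le_rfl
  have hum : Measurable (fun s => if s ≤ t then a else u₂ (s - t)) :=
    Measurable.ite measurableSet_Iic measurable_const (hu.comp (measurable_id.sub_const t))
  have hyc : Continuous (fun s => if s ≤ t then y₁ s else y₂ (s - t)) := by
    refine continuous_if_le continuous_id continuous_const hc.continuousOn
      (hy.comp (by fun_prop) fun s hs => ?_) fun s hs => ?_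
    · simpa using hs
    · simp [show s = t from hs, h0]
  refine ⟨hum, hyc.continuousOn, fun s hs => ?_⟩
  have key : ∀ r, 0 ≤ r → r ≤ t → ∫ τ in (0 : ℝ)..r, f (if τ ≤ t then y₁ τ else y₂ (τ - t))
      (if τ ≤ t then a else u₂ (τ - t)) = ∫ τ in (0 : ℝ)..r, f (y₁ τ) a := by
    intro r hr hrt
    refine intervalIntegral.integral_congr fun τ hτ => ?_
    rw [Set.uIcc_of_le hr] at hτ
    simp [hτ.2.trans hrt]
  rcases le_total s t with hst | hst
  · simp only [hst, if_true]
    rw [key s hs hst, h₁ s ⟨hs, hst⟩]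
  · rw [← intervalIntegral.integral_add_adjacent_intervals
      (intervalIntegrable_along hf hum hyc.continuousOn le_rfl ht)
      (intervalIntegrable_along hf hum hyc.continuousOn ht hs), key t ht le_rfl, ← add_assoc,
      ← h₁ t ⟨ht, le_rfl⟩]
    have e : ∫ τ in t..s, f (if τ ≤ t then y₁ τ else y₂ (τ - t))
      (if τ ≤ t then a else u₂ (τ - t)) = ∫ τ in t..s, f (y₂ (τ - t)) (u₂ (τ - t)) := by
      refine intervalIntegral.integral_congr_ae (Eventually.of_forall fun τ hτ => ?_)
      rw [Set.uIoc_of_le hst] at hτ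
      simp [not_le.2 hτ.1]
    rw [e, intervalIntegral.integral_comp_sub_right (fun τ => f (y₂ τ) (u₂ τ)), sub_self,
      ← hint _ (sub_nonneg.2 hst)]
    dsimp only
    split_ifs with h
    · simp [le_antisymm h hst, h0]
    · rfl

/-- Short-time existence of the trajectory with a constant control. -/
theorem exists_constant_control_trajectory {L : ℝ≥0} {a : U} {x : State m} {r B t : ℝ}
    (hfL : LipschitzWith L (fun z => f z a)) (hr : 0 ≤ r) (hB : 0 ≤ B)
    (hfB : ∀ z ∈ Metric.closedBall x r, ‖f z a‖ ≤ B) (ht : 0 ≤ t) (htB : B * t ≤ r) :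
    ∃ y : ℝ → State m, Continuous y ∧
      (∀ s ∈ Set.Icc 0 t, y s = x + ∫ τ in (0 : ℝ)..s, f (y τ) a) ∧
      (∀ s ∈ Set.Icc 0 t, dist (y s) x ≤ B * s) ∧ ∀ s, y s ∈ Metric.closedBall x r := by
  lift r to ℝ≥0 using hr
  lift B to ℝ≥0 using hB
  have hP : IsPicardLindelof (fun _ z => f z a) (tmin := 0) (tmax := t) ⟨0, le_rfl, ht⟩ x r 0 B L :=
    IsPicardLindelof.of_time_independent hfB hfL.lipschitzOnWith (by simpa [ht] using htB)
  -- The Picard fixed point is itself the integral equation, so no derivative is needed. `compProj`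
  -- clamps time to `[0, t]`, which makes the curve continuous and confined to the ball for all real
  -- times.
  obtain ⟨α, hα⟩ := ODE.FunSpace.exists_isFixedPt_next hP (Metric.mem_closedBall_self le_rfl)
  have hpic : ∀ s ∈ Set.Icc 0 t, α.compProj s = x + ∫ τ in (0 : ℝ)..s, f (α.compProj τ) a := by
    intro s hs
    conv_lhs => rw [← hα]
    rw [ODE.FunSpace.compProj_of_mem hs, ODE.FunSpace.next_apply, ODE.picard_apply]
  have hmem : ∀ s, α.compProj s ∈ Metric.closedBall x r := fun s =>
    α.compProj_mem_closedBall hP.mul_max_le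
  refine ⟨α.compProj, α.continuous_compProj, hpic, fun s hs => ?_, hmem⟩
  rw [hpic s hs, dist_self_add_left]
  have := intervalIntegral.norm_integral_le_of_norm_le_const (a := 0) (b := s)
    (f := fun τ => f (α.compProj τ) a) (C := B) fun τ _ => hfB _ (hmem τ)
  simpa [abs_of_nonneg hs.1] using this

end Processes

/-! ### Mollification of Lipschitz subsolutions -/

section Mollification

set_option linter.unusedSectionVars false

variable {m : ℕ} {U : Type*} [MetricSpace U] [CompactSpace U]
  {f : State m → U → State m}

theorem exists_forall_abs_sub_le_of_isCompact {g : State m → U → ℝ}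
    (hg : Continuous (Function.uncurry g)) {Y : Set (State m)} (hY : IsCompact Y) {ε : ℝ}
    (hε : 0 < ε) :
    ∃ ρ > 0, ∀ y ∈ Y, ∀ z, dist z y ≤ ρ → ∀ a, |g z a - g y a| ≤ ε := by
  have hK : IsCompact (Metric.cthickening 1 Y ×ˢ (Set.univ : Set U)) :=
    hY.cthickening.prod isCompact_univ
  obtain ⟨ρ, hρ, h⟩ := Metric.uniformContinuousOn_iff.1
    (hK.uniformContinuousOn_of_continuous hg.continuousOn) ε hε
  refine ⟨min 1 (ρ / 2), by positivity, fun y hy z hz a => ?_⟩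
  have h1 := h (z, a) ⟨Metric.mem_cthickening_of_dist_le z y 1 Y hy (hz.trans (min_le_left _ _)),
    trivial⟩ (y, a) ⟨Metric.self_subset_cthickening Y hy, trivial⟩ (by
      rw [Prod.dist_eq, dist_self, max_eq_left dist_nonneg]
      linarith [hz.trans (min_le_right _ _)])
  simpa [Real.dist_eq] using h1.le

theorem neg_le_fderiv_of_forall_le {φ : State m → ℝ} {y v : State m} {c t₀ : ℝ}
    (hφ : DifferentiableAt ℝ φ y) (ht₀ : 0 < t₀)
    (h : ∀ t ∈ Set.Ioo 0 t₀, φ y ≤ φ (y + t • v) + t * c) : -c ≤ fderiv ℝ φ y v := by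
  have hline : HasDerivAt (fun t : ℝ => φ (y + t • v)) (fderiv ℝ φ y v) 0 := by
    have h1 : HasDerivAt (fun t : ℝ => y + t • v) v 0 := by
      simpa using ((hasDerivAt_id (0 : ℝ)).smul_const v).const_add y
    have h2 : HasFDerivAt φ (fderiv ℝ φ y) (y + (0 : ℝ) • v) := by simpa using hφ.hasFDerivAt
    exact h2.comp_hasDerivAt 0 h1
  have hlim := hline.tendsto_slope_zero_right
  refine ge_of_tendsto hlim ?_
  filter_upwards [Ioo_mem_nhdsGT ht₀] with t ht
  have := h t ht
  simp only [zero_add, zero_smul, add_zero, smul_eq_mul]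
  rw [inv_mul_eq_div, le_div_iff₀ ht.1]
  linarith

/-- A Lipschitz function that satisfies the integrated inequality `∇V f + g ≥ 0` near `Y` is a
uniform limit of smooth functions that satisfy this inequality on `Y` up to a small error. -/
theorem exists_smooth_subsolution {V : State m → ℝ} {L Lf : ℝ≥0} (hV : LipschitzWith L V)
    (hfL : ∀ a, LipschitzWith Lf fun z => f z a) {g : State m → U → ℝ}
    (hg : Continuous (Function.uncurry g)) {Y : Set (State m)} (hY : IsCompact Y) {r : ℝ}
    (hr : 0 < r)
    (hsub : ∀ ε > 0, ∃ t₀ > 0, ∀ y ∈ Y, ∀ z, dist z y ≤ r → ∀ a, ∀ t ∈ Set.Ioo 0 t₀,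
      V z ≤ V (z + t • f z a) + t * (g z a + ε)) {ε : ℝ} (hε : 0 < ε) :
    ∃ φ : State m → ℝ, ContDiff ℝ 1 φ ∧ (∀ z, |φ z - V z| ≤ ε) ∧
      ∀ y ∈ Y, ∀ a, -ε ≤ fderiv ℝ φ y (f y a) + g y a := by
  obtain ⟨ρ, hρ, hgρ⟩ := exists_forall_abs_sub_le_of_isCompact hg hY (ε := ε / 3) (by positivity)
  obtain ⟨t₀, ht₀, hsub⟩ := hsub (ε / 3) (by positivity)
  -- The mollification radius must keep `y - w` where `hsub` and the modulus of `g` apply, make the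
  -- uniform error `L R` at most `ε`, and make the error `L Lf R` from the change of velocity at
  -- most `ε / 3`. With the slack `ε / 3` in `hsub` and the oscillation `ε / 3` of `g`, the total is
  -- `ε`.
  obtain ⟨R, hR, hRr, hRρ, hRV, hRf⟩ : ∃ R : ℝ, 0 < R ∧ R ≤ r ∧ R ≤ ρ ∧ L * R ≤ ε ∧
      L * (Lf * R) ≤ ε / 3 := by
    refine ⟨min (min r ρ) (min (ε / (L + 1)) (ε / 3 / (L * Lf + 1))), by positivity,
      (min_le_left _ _).trans (min_le_left _ _), (min_le_left _ _).trans (min_le_right _ _), ?_, ?_⟩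
    · have : min (min r ρ) (min (ε / (L + 1)) (ε / 3 / (L * Lf + 1))) ≤ ε / (L + 1) :=
        (min_le_right _ _).trans (min_le_left _ _)
      rw [le_div_iff₀ (by positivity)] at this
      have : 0 ≤ min (min r ρ) (min (ε / (L + 1)) (ε / 3 / (L * Lf + 1))) := by positivity
      linarith
    · have : min (min r ρ) (min (ε / (L + 1)) (ε / 3 / (L * Lf + 1))) ≤ ε / 3 / (L * Lf + 1) :=
        (min_le_right _ _).trans (min_le_right _ _)
      rw [le_div_iff₀ (by positivity)] at this
      have : 0 ≤ min (min r ρ) (min (ε / (L + 1)) (ε / 3 / (L * Lf + 1))) := by positivity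
      linarith
  let ψ : ContDiffBump (0 : State m) := ⟨R / 2, R, half_pos hR, half_lt_self hR⟩
  let φ : State m → ℝ := fun z => ∫ w, ψ.normed volume w * V (z - w)
  have hφ : ContDiff ℝ 1 φ :=
    ψ.hasCompactSupport_normed.contDiff_convolution_left (n := 1) (ContinuousLinearMap.lsmul ℝ ℝ)
      ψ.contDiff_normed (hV.continuous.locallyIntegrable (μ := volume))
  have hint : ∀ z, Integrable (fun w => ψ.normed volume w * V (z - w)) := fun z =>
    (ψ.continuous_normed.mul (hV.continuous.comp (by fun_prop))).integrable_of_hasCompactSupport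
      ψ.hasCompactSupport_normed.mul_right
  have hsupp : ∀ w, ψ.normed volume w ≠ 0 → ‖w‖ < R := fun w hw => by
    have : w ∈ Function.support (ψ.normed volume) := hw
    rw [ψ.support_normed_eq] at this
    simpa using this
  refine ⟨φ, hφ, fun z => ?_, fun y hy a => ?_⟩
  · refine ψ.dist_normed_convolution_le (g := V) hV.continuous.aestronglyMeasurable fun x hx => ?_
    refine (hV.dist_le_mul x z).trans (le_trans ?_ hRV)
    gcongr
    exact (Metric.mem_ball.1 hx).le
  · suffices h : -(g y a + ε) ≤ fderiv ℝ φ y (f y a) by linarith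
    refine neg_le_fderiv_of_forall_le (hφ.differentiable one_ne_zero y) ht₀ fun t ht => ?_
    have h1 : φ (y + t • f y a) + t * (g y a + ε) =
        ∫ w, ψ.normed volume w * (V (y + t • f y a - w) + t * (g y a + ε)) := by
      simp_rw [mul_add (ψ.normed volume _)]
      rw [integral_add (hint _) (ψ.integrable_normed.mul_const _), integral_mul_const,
        ψ.integral_normed, one_mul]
    rw [h1]
    refine integral_mono (hint _) ?_ fun w => ?_
    · simp_rw [mul_add (ψ.normed volume _)]
      exact (hint _).add (ψ.integrable_normed.mul_const _)
    · dsimp only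
      by_cases hw : ψ.normed volume w = 0
      · simp [hw]
      refine mul_le_mul_of_nonneg_left ?_ (ψ.nonneg_normed w)
      have hwR := (hsupp w hw).le
      have hd : dist (y - w) y ≤ R := by simpa [dist_eq_norm] using hwR
      have h2 := hsub y hy (y - w) (hd.trans hRr) a t ht
      have h3 := (abs_le.1 (hgρ y hy (y - w) (hd.trans hRρ) a)).2
      -- `hsub` moves `y - w` with its own velocity, whereas the mollified function moves every
      -- translate with the velocity at `y`. The Lipschitz bounds on `V` and `f` pay for the
      -- exchange.
      have h4 : V (y - w + t • f (y - w) a) - V (y + t • f y a - w) ≤ t * (ε / 3) := by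
        calc V (y - w + t • f (y - w) a) - V (y + t • f y a - w)
            ≤ dist (V (y - w + t • f (y - w) a)) (V (y + t • f y a - w)) := le_abs_self _
          _ ≤ L * dist (y - w + t • f (y - w) a) (y + t • f y a - w) := hV.dist_le_mul _ _
          _ = L * (t * dist (f (y - w) a) (f y a)) := by
            rw [show y + t • f y a - w = y - w + t • f y a by abel, dist_add_left, dist_smul₀,
              Real.norm_of_nonneg ht.1.le]
          _ ≤ L * (t * (Lf * R)) := by
            have := ht.1.le
            gcongr
            refine ((hfL a).dist_le_mul _ _).trans ?_
            gcongr
          _ = t * (L * (Lf * R)) := by ring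
          _ ≤ t * (ε / 3) := mul_le_mul_of_nonneg_left hRf ht.1.le
      nlinarith [ht.1]

end Mollification

/-! ### Testing the linear program with subsolutions -/

section LinearProgram

set_option linter.unusedSectionVars false

variable {m : ℕ} {U : Type*} [MetricSpace U] [CompactSpace U] [MeasurableSpace U] [BorelSpace U]
  {f : State m → U → State m} {Y : Set (State m)}

theorem integrable_of_continuous {X : Type*} [MetricSpace X] [CompactSpace X] [MeasurableSpace X]
    [OpensMeasurableSpace X] {μ : Measure X} [IsFiniteMeasure μ] {g : X → ℝ} (hg : Continuous g) :
    Integrable g μ := hg.integrable_of_hasCompactSupport (HasCompactSupport.of_compactSpace g)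

theorem integrable_on_prod (hY : IsCompact Y) {μ : Measure (Y × U)} [IsFiniteMeasure μ]
    {g : State m → U → ℝ} (hg : Continuous (Function.uncurry g)) :
    Integrable (fun p : Y × U => g p.1 p.2) μ := by
  have : CompactSpace Y := isCompact_iff_compactSpace.1 hY
  have : SecondCountableTopology U := EMetric.secondCountable_of_sigmaCompact U
  exact integrable_of_continuous (hg.comp (by fun_prop : Continuous fun p : Y × U =>
    ((p.1 : State m), p.2)))

theorem continuous_fderiv_apply_field (hf : Continuous (Function.uncurry f)) {φ : State m → ℝ}
    (hφ : ContDiff ℝ 1 φ) :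
    Continuous (Function.uncurry fun z a => fderiv ℝ φ z (f z a)) :=
  ((hφ.continuous_fderiv one_ne_zero).comp continuous_fst).clm_apply hf

/-- `V` is bounded above, along every short piece of trajectory with constant control that starts
at distance at most `r` from `Y`, as if it satisfied `∇V f + g ≥ 0`. -/
def IsSubsolution (f : State m → U → State m) (Y : Set (State m)) (r : ℝ) (V : State m → ℝ)
    (g : State m → U → ℝ) : Prop :=
  ∀ ε > 0, ∃ t₀ > 0, ∀ y ∈ Y, ∀ z, dist z y ≤ r → ∀ a, ∀ t ∈ Set.Ioo 0 t₀,
      V z ≤ V (z + t • f z a) + t * (g z a + ε)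

variable {V : State m → ℝ} {L Lf : ℝ≥0} {g : State m → U → ℝ} {r : ℝ}

/-- For a smooth approximation the gradient term integrates to zero against an invariant measure, so
only `g` survives. -/
theorem IsSubsolution.integral_nonneg (h : IsSubsolution f Y r V g) (hV : LipschitzWith L V)
    (hf : Continuous (Function.uncurry f))
    (hfL : ∀ a, LipschitzWith Lf fun z => f z a) (hg : Continuous (Function.uncurry g))
    (hY : IsCompact Y) (hr : 0 < r) {γ : ProbabilityMeasure (Y × U)}
    (hγ : γ ∈ invariantMeasures f Y) :
    0 ≤ ∫ p, g (p.1 : State m) p.2 ∂(γ : Measure (Y × U)) := by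
  refine le_of_forall_pos_le_add fun ε hε => ?_
  obtain ⟨φ, hφ, -, hφf⟩ := exists_smooth_subsolution hV hfL hg hY hr h hε
  have hi := integrable_on_prod hY (μ := (γ : Measure (Y × U)))
    (continuous_fderiv_apply_field hf hφ)
  have hgi := integrable_on_prod hY (μ := (γ : Measure (Y × U))) hg
  have h1 : ∫ p, (-ε) ∂(γ : Measure (Y × U)) ≤
      ∫ p, (fderiv ℝ φ (p.1 : State m) (f p.1 p.2) + g p.1 p.2) ∂(γ : Measure (Y × U)) :=
    integral_mono (integrable_const _) (hi.add hgi) fun p => hφf p.1 p.1.2 p.2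
  rw [integral_add hi hgi, hγ φ hφ] at h1
  simp at h1
  linarith

/-- Weak duality: a smooth approximation of `V` is inserted in the equality constraint of `Ω(y₀)`,
and its gradient term is bounded below by `-g - ε`. -/
theorem IsSubsolution.sub_integral_le (h : IsSubsolution f Y r V g) (hV : LipschitzWith L V)
    (hf : Continuous (Function.uncurry f))
    (hfL : ∀ a, LipschitzWith Lf fun z => f z a) (hg : Continuous (Function.uncurry g))
    (hY : IsCompact Y) (hr : 0 < r) {y₀ : State m}
    {π : ProbabilityMeasure (Y × U) × FiniteMeasure (Y × U)} (hπ : π ∈ feasibleSet f Y y₀) :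
    V y₀ - ∫ p, V (p.1 : State m) ∂(π.1 : Measure (Y × U)) ≤
      ∫ p, g (p.1 : State m) p.2 ∂(π.2 : Measure (Y × U)) := by
  -- The error `ε` occurs twice in `|φ - V| ≤ ε`, at `y₀` and under the probability measure `γ`, and
  -- once in the gradient inequality, weighted by the mass of `ξ`.
  set C : ℝ := 2 + (π.2 : Measure (Y × U)).real Set.univ with hC
  have hCpos : 0 < C := by positivity
  refine le_of_forall_pos_le_add fun η hη => ?_
  have hε : 0 < η / C := by positivity
  have hεC : η / C * C = η := by field_simp
  set ε := η / C
  obtain ⟨φ, hφ, hφV, hφf⟩ := exists_smooth_subsolution hV hfL hg hY hr h hε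
  have hi := integrable_on_prod hY (μ := (π.2 : Measure (Y × U)))
    (continuous_fderiv_apply_field hf hφ)
  have hgi := integrable_on_prod hY (μ := (π.2 : Measure (Y × U))) hg
  have hφi := integrable_on_prod hY (μ := (π.1 : Measure (Y × U))) (g := fun z _ => φ z)
    (hφ.continuous.comp continuous_fst)
  have hVi := integrable_on_prod hY (μ := (π.1 : Measure (Y × U))) (g := fun z _ => V z)
    (hV.continuous.comp continuous_fst)
  have h1 : ∫ p, (-ε) ∂(π.2 : Measure (Y × U)) ≤
      ∫ p, (fderiv ℝ φ (p.1 : State m) (f p.1 p.2) + g p.1 p.2) ∂(π.2 : Measure (Y × U)) :=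
    integral_mono (integrable_const _) (hi.add hgi) fun p => hφf p.1 p.1.2 p.2
  have h2 : ∫ p, φ (p.1 : State m) ∂(π.1 : Measure (Y × U)) ≤
      ∫ p, (V (p.1 : State m) + ε) ∂(π.1 : Measure (Y × U)) :=
    integral_mono hφi (hVi.add (integrable_const _)) fun p => by
      have := (abs_le.1 (hφV p.1)).2
      dsimp only
      linarith
  have h3 := hπ.2 φ hφ
  have h4 := (abs_le.1 (hφV y₀)).1
  rw [integral_add hi hgi] at h1
  rw [integral_add hVi (integrable_const _)] at h2
  rw [integral_sub (integrable_const _) hφi] at h3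
  simp only [integral_const, probReal_univ, smul_eq_mul, one_mul] at h1 h2 h3
  have h5 : ε * C = 2 * ε + ε * (π.2 : Measure (Y × U)).real Set.univ := by rw [hC]; ring
  linarith

end LinearProgram

/-! ### Dynamic programming for the two value functions -/

section Values

set_option linter.unusedSectionVars false

variable {m : ℕ} {U : Type*} [MetricSpace U] [CompactSpace U] [MeasurableSpace U] [BorelSpace U]
  {f : State m → U → State m} {k : State m → U → ℝ} {K Y : Set (State m)}

theorem eventually_mul_le (C : ℝ) {η : ℝ} (hη : 0 < η) : ∀ᶠ t : ℝ in 𝓝[>] 0, C * t ≤ η := by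
  have h : Tendsto (fun t : ℝ => C * t) (𝓝[>] 0) (𝓝 0) := by
    have : Tendsto (fun t : ℝ => C * t) (𝓝 0) (𝓝 (C * 0)) :=
      tendsto_id.const_mul C
    simpa using this.mono_left nhdsWithin_le_nhds
  exact h.eventually_le_const hη

theorem exists_pos_forall_Ioo {p : ℝ → Prop} (h : ∀ᶠ t in 𝓝[>] 0, p t) :
    ∃ t₀ > 0, ∀ t ∈ Set.Ioo (0 : ℝ) t₀, p t :=
  (mem_nhdsGT_iff_exists_Ioo_subset (a := (0 : ℝ))).1 h

/-- First-order expansion of a short trajectory with constant control. -/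
theorem exists_short_trajectory {Lf : ℝ≥0} (hfL : ∀ a, LipschitzWith Lf fun z => f z a)
    (hf : Continuous (Function.uncurry f))
    {r B t : ℝ} {y z : State m} {a : U} (hr : 0 ≤ r) (hB : 0 ≤ B)
    (hfB : ∀ w ∈ K, ∀ a, ‖f w a‖ ≤ B) (hK : ∀ w, dist w y ≤ 2 * r → w ∈ K)
    (hz : dist z y ≤ r) (ht : 0 ≤ t) (htB : B * t ≤ r) :
    ∃ y₁ : ℝ → State m, Continuous y₁ ∧
      (∀ s ∈ Set.Icc 0 t, y₁ s = z + ∫ τ in (0 : ℝ)..s, f (y₁ τ) a) ∧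
      (∀ s ∈ Set.Icc 0 t, dist (y₁ s) z ≤ B * s) ∧ (∀ s, y₁ s ∈ K) ∧
      dist (y₁ t) (z + t • f z a) ≤ Lf * B * t * t := by
  have hball : ∀ w ∈ Metric.closedBall z r, w ∈ K := fun w hw => hK w (by
    linarith [dist_triangle w z y, Metric.mem_closedBall.1 hw])
  obtain ⟨y₁, hc, hy₁, hd, hm⟩ := exists_constant_control_trajectory (hfL a) hr hB
    (fun w hw => hfB w (hball w hw) a) ht htB
  refine ⟨y₁, hc, hy₁, hd, fun s => hball _ (hm s), ?_⟩
  have hcf : Continuous fun τ => f (y₁ τ) a := hf.comp (hc.prodMk continuous_const)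
  have h1 : y₁ t - (z + t • f z a) = ∫ τ in (0 : ℝ)..t, (f (y₁ τ) a - f z a) := by
    rw [intervalIntegral.integral_sub (hcf.intervalIntegrable _ _) (by simp), hy₁ t ⟨ht, le_rfl⟩]
    simp
  rw [dist_eq_norm, h1]
  have := intervalIntegral.norm_integral_le_of_norm_le_const (a := 0) (b := t)
    (f := fun τ => f (y₁ τ) a - f z a) (C := Lf * B * t) fun τ hτ => by
      rw [Set.uIoc_of_le ht] at hτ
      rw [← dist_eq_norm, mul_assoc]
      refine ((hfL a).dist_le_mul _ _).trans ?_
      refine mul_le_mul_of_nonneg_left ((hd τ ⟨hτ.1.le, hτ.2⟩).trans ?_) Lf.2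
      exact mul_le_mul_of_nonneg_left hτ.2 hB
  simpa [abs_of_nonneg ht] using this

/-! ### Time averages -/

theorem IsAdmissible.upTo {y₀ : State m} {u : ℝ → U} {y : ℝ → State m}
    (h : IsAdmissible f K y₀ u y) (T : ℝ) : IsAdmissibleUpTo f K T y₀ u y :=
  ⟨h.1, fun t ht => h.2 t ht.1⟩

theorem IsAdmissibleUpTo.abs_integral_le {M a b T : ℝ} (hM : ∀ z ∈ K, ∀ c, ‖k z c‖ ≤ M)
    {y₀ : State m} {u : ℝ → U} {y : ℝ → State m} (h : IsAdmissibleUpTo f K T y₀ u y)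
    (ha : 0 ≤ a) (hab : a ≤ b) (hb : b ≤ T) :
    |∫ t in a..b, k (y t) (u t)| ≤ M * (b - a) := by
  have := intervalIntegral.norm_integral_le_of_norm_le_const (a := a) (b := b)
    (f := fun t => k (y t) (u t)) (C := M) fun t ht => by
      rw [Set.uIoc_of_le hab] at ht
      exact hM _ (h.2 t ⟨ha.trans ht.1.le, ht.2.trans hb⟩) _
  rwa [abs_of_nonneg (sub_nonneg.2 hab)] at this

theorem cesaroValue_le {M T : ℝ} (hM : ∀ z ∈ K, ∀ c, ‖k z c‖ ≤ M) (hT : 0 < T)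
    {y₀ : State m} {u : ℝ → U} {y : ℝ → State m} (h : IsAdmissibleUpTo f K T y₀ u y) :
    cesaroValue f k K T y₀ ≤ (1 / T) * ∫ t in (0 : ℝ)..T, k (y t) (u t) := by
  -- A real `sInf` is a lower bound only for a set bounded below; the bound on `k` provides this.
  refine mul_le_mul_of_nonneg_left (csInf_le ⟨-(M * (T - 0)), ?_⟩ ⟨u, y, h, rfl⟩) (by positivity)
  rintro c ⟨u', y', h', rfl⟩
  exact (abs_le.1 (h'.abs_integral_le hM le_rfl hT.le le_rfl)).1

theorem exists_lt_cesaroValue_add (hv : IsViable f K) {T η : ℝ} (hT : 0 < T) {y₀ : State m}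
    (hy₀ : y₀ ∈ K) (hη : 0 < η) : ∃ u y, IsAdmissibleUpTo f K T y₀ u y ∧
      (1 / T) * ∫ t in (0 : ℝ)..T, k (y t) (u t) < cesaroValue f k K T y₀ + η := by
  obtain ⟨u₀, y', h₀⟩ := hv y₀ hy₀
  obtain ⟨c, ⟨u, y, h, rfl⟩, hc⟩ := exists_lt_of_csInf_lt
    (s := {c : ℝ | ∃ u y, IsAdmissibleUpTo f K T y₀ u y ∧ c = ∫ t in (0 : ℝ)..T, k (y t) (u t)})
    ⟨_, u₀, y', h₀.upTo T, rfl⟩ (lt_add_of_pos_right _ (mul_pos hη hT))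
  refine ⟨u, y, h, ?_⟩
  have := mul_lt_mul_of_pos_left hc (one_div_pos.2 hT)
  rw [mul_add] at this
  refine this.trans_eq ?_
  rw [cesaroValue]
  field_simp

/-- Along any trajectory the unnormalised value `T V_T` decreases at most at rate `2 M`. -/
theorem cesaroValue_le_add (hf : Continuous (Function.uncurry f))
    (hk : Continuous (Function.uncurry k)) {M T t : ℝ} (hM : ∀ z ∈ K, ∀ c, ‖k z c‖ ≤ M)
    (hv : IsViable f K) (ht : 0 ≤ t) (htT : t ≤ T) (hT : 0 < T) {y₁ : ℝ → State m} {a : U}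
    {z : State m} (hc : Continuous y₁)
    (h₁ : ∀ s ∈ Set.Icc 0 t, y₁ s = z + ∫ τ in (0 : ℝ)..s, f (y₁ τ) a) (hK : ∀ s, y₁ s ∈ K) :
    cesaroValue f k K T z ≤ cesaroValue f k K T (y₁ t) + t * (2 * M / T) := by
  refine le_of_forall_pos_le_add fun η hη => ?_
  -- The second process is nearly optimal on all of `[0, T]`, but after concatenation only its part
  -- on `[0, T - t]` is used. The inserted initial piece and the dropped final piece each cost at
  -- most `M t`, hence `2 M t / T`.
  obtain ⟨u₂, y₂, h₂, hlt⟩ := exists_lt_cesaroValue_add (k := k) hv hT (hK t) hη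
  have hcc := IsProcess.concat hf ht hc h₁ h₂.1
  have hadm : IsAdmissibleUpTo f K T z (fun s => if s ≤ t then a else u₂ (s - t))
      (fun s => if s ≤ t then y₁ s else y₂ (s - t)) := by
    refine ⟨hcc, fun s hs => ?_⟩
    dsimp only
    split_ifs with h
    · exact hK s
    · exact h₂.2 _ ⟨by linarith, by linarith [hs.2]⟩
  have h3 := cesaroValue_le hM hT hadm
  have hi := fun {a b : ℝ} => intervalIntegrable_along hk hcc.1 hcc.2.1 (a := a) (b := b)
  have hi₂ := fun {a b : ℝ} => intervalIntegrable_along hk h₂.1.1 h₂.1.2.1 (a := a) (b := b)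
  have h4 := hadm.abs_integral_le hM le_rfl ht htT
  have h5 := h₂.abs_integral_le hM (sub_nonneg.2 htT) (sub_le_self T ht) le_rfl
  have h6 : ∫ s in t..T, k (if s ≤ t then y₁ s else y₂ (s - t)) (if s ≤ t then a else u₂ (s - t)) =
      ∫ s in (0 : ℝ)..(T - t), k (y₂ s) (u₂ s) := by
    rw [← sub_self t, ← intervalIntegral.integral_comp_sub_right (fun s => k (y₂ s) (u₂ s))]
    refine intervalIntegral.integral_congr_ae (Eventually.of_forall fun s hs => ?_)
    rw [Set.uIoc_of_le htT] at hs
    simp [not_le.2 hs.1]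
  rw [← intervalIntegral.integral_add_adjacent_intervals (hi le_rfl ht) (hi ht hT.le), h6] at h3
  have h7 := intervalIntegral.integral_add_adjacent_intervals (hi₂ le_rfl (sub_nonneg.2 htT))
    (hi₂ (sub_nonneg.2 htT) hT.le)
  rw [← h7] at hlt
  have h8 := (abs_le.1 h4).2
  have h9 := (abs_le.1 h5).1
  have h10 : (1 / T) * (M * (t - 0) + M * (T - (T - t))) = t * (2 * M / T) := by
    field_simp
    ring
  rw [← h10]
  have h11 := mul_le_mul_of_nonneg_left (add_le_add h8 (neg_le.1 h9)) (one_div_pos.2 hT).le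
  linarith [mul_add (1 / T) (∫ s in (0 : ℝ)..t, k (if s ≤ t then y₁ s else y₂ (s - t))
    (if s ≤ t then a else u₂ (s - t))) (∫ s in (0 : ℝ)..(T - t), k (y₂ s) (u₂ s))]

theorem isSubsolution_cesaroValue (hf : Continuous (Function.uncurry f))
    (hk : Continuous (Function.uncurry k)) {Lf L : ℝ≥0}
    (hfL : ∀ a, LipschitzWith Lf fun z => f z a) {M T r : ℝ} (hKc : IsCompact K)
    (hM : ∀ z ∈ K, ∀ c, ‖k z c‖ ≤ M) (hv : IsViable f K) (hT : 0 < T) (hr : 0 < r)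
    (hYK : ∀ y ∈ Y, ∀ w, dist w y ≤ 2 * r → w ∈ K) {V : State m → ℝ} (hV : LipschitzWith L V)
    (hVK : Set.EqOn (cesaroValue f k K T) V K) :
    IsSubsolution f Y r V (fun _ _ => 2 * M / T) := by
  obtain ⟨B, hB, hfB⟩ := exists_norm_le_of_isCompact hf hKc
  intro ε hε
  -- The three conditions keep the trajectory in `K`, keep `t` below the horizon, and absorb in `ε`
  -- the quadratic distance between the trajectory and its tangent.
  obtain ⟨t₀, ht₀, h⟩ := exists_pos_forall_Ioo (((eventually_mul_le B hr).and
    (eventually_mul_le 1 hT)).and (eventually_mul_le (L * (Lf * B)) hε))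
  refine ⟨t₀, ht₀, fun y hy z hz a t ht => ?_⟩
  obtain ⟨⟨h1, h2⟩, h3⟩ := h t ht
  obtain ⟨y₁, hc, hy₁, -, hmem, hd⟩ := exists_short_trajectory hfL hf hr.le hB.le hfB (hYK y hy)
    hz ht.1.le h1 (a := a)
  have h4 := cesaroValue_le_add hf hk hM hv ht.1.le (by linarith) hT hc hy₁ hmem
  rw [hVK (hYK y hy z (by linarith)), hVK (hmem t)] at h4
  have h5 : V (y₁ t) - V (z + t • f z a) ≤ L * (Lf * B * t * t) :=
    (le_abs_self _).trans ((hV.dist_le_mul _ _).trans (mul_le_mul_of_nonneg_left hd L.2))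
  have h6 := mul_le_mul_of_nonneg_left h3 ht.1.le
  nlinarith

/-! ### Discounted averages -/

theorem integrableOn_exp_neg_mul {lam : ℝ} (hlam : 0 < lam) :
    IntegrableOn (fun t : ℝ => Real.exp (-lam * t)) (Set.Ioi 0) :=
  integrableOn_exp_mul_Ioi (by linarith) 0

theorem integral_exp_neg_mul {lam : ℝ} (hlam : 0 < lam) :
    ∫ t in Set.Ioi (0 : ℝ), Real.exp (-lam * t) = 1 / lam := by
  rw [integral_exp_mul_Ioi (by linarith)]
  simp [neg_div_neg_eq]

theorem IsAdmissible.norm_discounted_le {M lam : ℝ} (hM : ∀ z ∈ K, ∀ c, ‖k z c‖ ≤ M)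
    {y₀ : State m} {u : ℝ → U} {y : ℝ → State m} (h : IsAdmissible f K y₀ u y) :
    ∀ᵐ t ∂(volume.restrict (Set.Ioi (0 : ℝ))),
      ‖Real.exp (-lam * t) * k (y t) (u t)‖ ≤ Real.exp (-lam * t) * M := by
  filter_upwards [ae_restrict_mem measurableSet_Ioi] with t ht
  rw [norm_mul, Real.norm_of_nonneg (Real.exp_pos _).le]
  exact mul_le_mul_of_nonneg_left (hM _ (h.2 t (Set.Ioi_subset_Ici_self ht)) _) (Real.exp_pos _).le

theorem IsAdmissible.integrableOn_discounted (hk : Continuous (Function.uncurry k)) {M lam : ℝ}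
    (hlam : 0 < lam) (hM : ∀ z ∈ K, ∀ c, ‖k z c‖ ≤ M)
    {y₀ : State m} {u : ℝ → U} {y : ℝ → State m} (h : IsAdmissible f K y₀ u y) :
    IntegrableOn (fun t => Real.exp (-lam * t) * k (y t) (u t)) (Set.Ioi 0) := by
  refine ((integrableOn_exp_neg_mul hlam).mul_const M).mono' ?_ (h.norm_discounted_le hM)
  refine AEStronglyMeasurable.mul (by fun_prop) ?_
  exact AEStronglyMeasurable.mono_measure (aestronglyMeasurable_along hk h.1.1 h.1.2.1)
    (Measure.restrict_mono Set.Ioi_subset_Ici_self (le_refl volume))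

theorem IsAdmissible.abs_discounted_le {M lam : ℝ}
    (hlam : 0 < lam) (hM : ∀ z ∈ K, ∀ c, ‖k z c‖ ≤ M)
    {y₀ : State m} {u : ℝ → U} {y : ℝ → State m} (h : IsAdmissible f K y₀ u y) :
    |∫ t in Set.Ioi (0 : ℝ), Real.exp (-lam * t) * k (y t) (u t)| ≤ M / lam := by
  have := norm_integral_le_of_norm_le ((integrableOn_exp_neg_mul hlam).mul_const M)
    (h.norm_discounted_le hM)
  rw [integral_mul_const, integral_exp_neg_mul hlam, one_div_mul_eq_div] at this
  exact this

theorem abelValue_le {M lam : ℝ} (hM : ∀ z ∈ K, ∀ c, ‖k z c‖ ≤ M)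
    (hlam : 0 < lam) {y₀ : State m} {u : ℝ → U} {y : ℝ → State m} (h : IsAdmissible f K y₀ u y) :
    abelValue f k K lam y₀ ≤
      lam * ∫ t in Set.Ioi (0 : ℝ), Real.exp (-lam * t) * k (y t) (u t) := by
  refine mul_le_mul_of_nonneg_left (csInf_le ⟨-(M / lam), ?_⟩ ⟨u, y, h, rfl⟩) hlam.le
  rintro c ⟨u', y', h', rfl⟩
  exact (abs_le.1 (h'.abs_discounted_le hlam hM)).1

theorem exists_lt_abelValue_add (hv : IsViable f K) {lam η : ℝ} (hlam : 0 < lam) {y₀ : State m}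
    (hy₀ : y₀ ∈ K) (hη : 0 < η) : ∃ u y, IsAdmissible f K y₀ u y ∧
      lam * ∫ t in Set.Ioi (0 : ℝ), Real.exp (-lam * t) * k (y t) (u t) <
        abelValue f k K lam y₀ + η := by
  obtain ⟨u₀, y', h₀⟩ := hv y₀ hy₀
  obtain ⟨c, ⟨u, y, h, rfl⟩, hc⟩ := exists_lt_of_csInf_lt
    (s := {c : ℝ | ∃ u y, IsAdmissible f K y₀ u y ∧
      c = ∫ t in Set.Ioi (0 : ℝ), Real.exp (-lam * t) * k (y t) (u t)})
    ⟨_, u₀, y', h₀, rfl⟩ (lt_add_of_pos_right _ (div_pos hη hlam))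
  refine ⟨u, y, h, ?_⟩
  have := mul_lt_mul_of_pos_left hc hlam
  rw [mul_add, mul_div_cancel₀ _ hlam.ne'] at this
  exact this

theorem abs_abelValue_le (hv : IsViable f K) {M lam : ℝ} (hM : ∀ z ∈ K, ∀ c, ‖k z c‖ ≤ M)
    (hlam : 0 < lam) {y₀ : State m} (hy₀ : y₀ ∈ K) : |abelValue f k K lam y₀| ≤ M := by
  have key : ∀ {u : ℝ → U} {y : ℝ → State m}, IsAdmissible f K y₀ u y →
      |lam * ∫ t in Set.Ioi (0 : ℝ), Real.exp (-lam * t) * k (y t) (u t)| ≤ M := by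
    intro u y h
    rw [abs_mul, abs_of_pos hlam, ← le_div_iff₀' hlam]
    exact h.abs_discounted_le hlam hM
  rw [abs_le]
  constructor
  · refine le_of_forall_pos_le_add fun η hη => ?_
    obtain ⟨u, y, h, hlt⟩ := exists_lt_abelValue_add (k := k) hv hlam hy₀ hη
    linarith [(abs_le.1 (key h)).1]
  · obtain ⟨u, y, h⟩ := hv y₀ hy₀
    exact (abelValue_le hM hlam h).trans (abs_le.1 (key h)).2

/-- Dynamic programming inequality for the discounted problem. -/
theorem abelValue_le_add (hf : Continuous (Function.uncurry f))
    (hk : Continuous (Function.uncurry k)) {M lam t : ℝ} (hM : ∀ z ∈ K, ∀ c, ‖k z c‖ ≤ M)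
    (hv : IsViable f K) (ht : 0 ≤ t) (hlam : 0 < lam) {y₁ : ℝ → State m} {a : U}
    {z : State m} (hc : Continuous y₁)
    (h₁ : ∀ s ∈ Set.Icc 0 t, y₁ s = z + ∫ τ in (0 : ℝ)..s, f (y₁ τ) a) (hK : ∀ s, y₁ s ∈ K) :
    abelValue f k K lam z ≤ lam * (∫ s in (0 : ℝ)..t, Real.exp (-lam * s) * k (y₁ s) a) +
      Real.exp (-lam * t) * abelValue f k K lam (y₁ t) := by
  refine le_of_forall_pos_le_add fun η hη => ?_
  obtain ⟨u₂, y₂, h₂, hlt⟩ := exists_lt_abelValue_add (k := k) hv hlam (hK t) hη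
  have hcc := IsProcess.concat hf ht hc h₁ h₂.1
  have hadm : IsAdmissible f K z (fun s => if s ≤ t then a else u₂ (s - t))
      (fun s => if s ≤ t then y₁ s else y₂ (s - t)) := by
    refine ⟨hcc, fun s hs => ?_⟩
    dsimp only
    split_ifs with h
    · exact hK s
    · exact h₂.2 _ (by simp only [Set.mem_Ici]; linarith)
  have h3 := abelValue_le hM hlam hadm
  have hi := hadm.integrableOn_discounted hk hlam hM
  rw [← Set.Ioc_union_Ioi_eq_Ioi ht, setIntegral_union (Set.Ioc_disjoint_Ioi le_rfl)
    measurableSet_Ioi (hi.mono_set Set.Ioc_subset_Ioi_self)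
    (hi.mono_set (Set.Ioi_subset_Ioi ht))] at h3
  have e1 : ∫ s in Set.Ioc 0 t, Real.exp (-lam * s) *
      k (if s ≤ t then y₁ s else y₂ (s - t)) (if s ≤ t then a else u₂ (s - t)) =
      ∫ s in (0 : ℝ)..t, Real.exp (-lam * s) * k (y₁ s) a := by
    rw [intervalIntegral.integral_of_le ht]
    refine setIntegral_congr_fun measurableSet_Ioc fun s hs => ?_
    simp [hs.2]
  have e2 : ∫ s in Set.Ioi t, Real.exp (-lam * s) *
      k (if s ≤ t then y₁ s else y₂ (s - t)) (if s ≤ t then a else u₂ (s - t)) =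
      Real.exp (-lam * t) * ∫ s in Set.Ioi (0 : ℝ), Real.exp (-lam * s) * k (y₂ s) (u₂ s) := by
    have hpre : (fun s : ℝ => s - t) ⁻¹' Set.Ioi 0 = Set.Ioi t := by ext; simp
    rw [← (measurePreserving_sub_right volume t).setIntegral_preimage_emb
      (measurableEmbedding_subRight t) (fun s => Real.exp (-lam * s) * k (y₂ s) (u₂ s)) (Set.Ioi 0),
      hpre, ← integral_const_mul]
    refine setIntegral_congr_fun measurableSet_Ioi fun s hs => ?_
    simp only [not_le.2 (Set.mem_Ioi.1 hs), if_false]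
    rw [← mul_assoc, ← Real.exp_add]
    ring_nf
  rw [e1, e2] at h3
  have h4 := mul_le_mul_of_nonneg_left hlt.le (Real.exp_pos (-lam * t)).le
  have h5 : Real.exp (-lam * t) * η ≤ η :=
    mul_le_of_le_one_left hη.le (Real.exp_le_one_iff.2 (by nlinarith))
  nlinarith

/-- This is the first-order expansion in `t` of `abelValue_le_add`: the running cost contributes `λ
t k(z, a)` and the discount factor `-λ t V(z)`. -/
theorem isSubsolution_abelValue (hf : Continuous (Function.uncurry f))
    (hk : Continuous (Function.uncurry k)) {Lf L : ℝ≥0}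
    (hfL : ∀ a, LipschitzWith Lf fun z => f z a) {M lam r : ℝ} (hKc : IsCompact K)
    (hM : ∀ z ∈ K, ∀ c, ‖k z c‖ ≤ M) (hv : IsViable f K) (hlam : 0 < lam) (hr : 0 < r)
    (hYK : ∀ y ∈ Y, ∀ w, dist w y ≤ 2 * r → w ∈ K) {V : State m → ℝ} (hV : LipschitzWith L V)
    (hVK : Set.EqOn (abelValue f k K lam) V K) :
    IsSubsolution f Y r V (fun z a => lam * (k z a - V z)) := by
  obtain ⟨B, hB, hfB⟩ := exists_norm_le_of_isCompact hf hKc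
  intro ε hε
  obtain ⟨ρ, hρ, hkρ⟩ := exists_forall_abs_sub_le_of_isCompact hk hKc
    (ε := ε / (2 * lam)) (by positivity)
  -- The summands of the last constant are the coefficients of `t²` in four errors: trajectory
  -- against tangent, discounting of the running cost, `V (y₁ t)` against `V z`, and the remainder
  -- of the exponential. They use half of `ε`; the oscillation of `k` uses the other half.
  obtain ⟨t₀, ht₀, h⟩ := exists_pos_forall_Ioo (((eventually_mul_le B hr).and
    (eventually_mul_le B hρ)).and ((eventually_mul_le lam one_pos).and (eventually_mul_le
      (L * (Lf * B) + lam ^ 2 * M + lam * (L * B) + lam ^ 2 * M) (half_pos hε))))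
  refine ⟨t₀, ht₀, fun y hy z hz a t ht => ?_⟩
  obtain ⟨⟨h1, h2⟩, h3, h4⟩ := h t ht
  have ht' := ht.1.le
  obtain ⟨y₁, hc, hy₁, hdz, hmem, hd⟩ := exists_short_trajectory hfL hf hr.le hB.le hfB (hYK y hy)
    hz ht' h1 (a := a)
  have hzK : z ∈ K := hYK y hy z (by linarith)
  have hM0 : 0 ≤ M := (norm_nonneg _).trans (hM z hzK a)
  have h5 := abelValue_le_add hf hk hM hv ht' hlam hc hy₁ hmem
  have hbound := abs_abelValue_le (k := k) hv hM hlam (hmem t)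
  rw [hVK hzK, hVK (hmem t)] at h5
  rw [hVK (hmem t)] at hbound
  have h6 : V (y₁ t) - V (z + t • f z a) ≤ L * (Lf * B * t * t) :=
    (le_abs_self _).trans ((hV.dist_le_mul _ _).trans (mul_le_mul_of_nonneg_left hd L.2))
  have h7 : V z - V (y₁ t) ≤ L * (B * t) := by
    refine (le_abs_self _).trans ((hV.dist_le_mul _ _).trans (mul_le_mul_of_nonneg_left ?_ L.2))
    rw [dist_comm]
    exact hdz t ⟨ht', le_rfl⟩
  have h8 : ∫ s in (0 : ℝ)..t, Real.exp (-lam * s) * k (y₁ s) a ≤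
      t * (k z a + ε / (2 * lam) + lam * t * M) := by
    have hcont : Continuous fun s => Real.exp (-lam * s) * k (y₁ s) a :=
      (by fun_prop : Continuous fun s : ℝ => Real.exp (-lam * s)).mul
        (hk.comp (hc.prodMk continuous_const))
    have := intervalIntegral.integral_mono_on (μ := volume) ht' (hcont.intervalIntegrable 0 t)
      (intervalIntegrable_const (c := k z a + ε / (2 * lam) + lam * t * M)) fun s hs => by
        have hk1 := (abs_le.1 (hkρ z hzK (y₁ s) ((hdz s hs).trans
          ((mul_le_mul_of_nonneg_left hs.2 hB.le).trans h2)) a)).2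
        have hk2 := abs_le.1 (hM _ (hmem s) a)
        have he1 := Real.add_one_le_exp (-lam * s)
        have he2 : Real.exp (-lam * s) ≤ 1 := Real.exp_le_one_iff.2 (by nlinarith [hs.1])
        have he3 : lam * s ≤ lam * t := mul_le_mul_of_nonneg_left hs.2 hlam.le
        -- Writing `e k = k + (1 - e)(-k)` removes the discount factor `e` whatever the sign of `k`.
        have he4 : (1 - Real.exp (-lam * s)) * (-k (y₁ s) a) ≤ (1 - Real.exp (-lam * s)) * M :=
          mul_le_mul_of_nonneg_left (by linarith) (by linarith)
        have he5 : (1 - Real.exp (-lam * s)) * M ≤ lam * t * M :=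
          mul_le_mul_of_nonneg_right (by linarith) hM0
        linarith
    rwa [intervalIntegral.integral_const, sub_zero, smul_eq_mul] at this
  have h9 : Real.exp (-lam * t) * V (y₁ t) ≤ (1 - lam * t) * V (y₁ t) + (lam * t) ^ 2 * M := by
    have he := Real.abs_exp_sub_one_sub_id_le (x := -lam * t)
      (by rw [neg_mul, abs_neg, abs_of_nonneg (by positivity)]; linarith)
    have : (Real.exp (-lam * t) - 1 - -lam * t) * V (y₁ t) ≤ (-lam * t) ^ 2 * M := by
      refine (le_abs_self _).trans ?_
      rw [abs_mul]
      exact mul_le_mul he hbound (abs_nonneg _) (sq_nonneg _)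
    linarith
  have h10 := mul_le_mul_of_nonneg_left h8 hlam.le
  have h11 := mul_le_mul_of_nonneg_left h7 (mul_nonneg hlam.le ht')
  have h12 := mul_le_mul_of_nonneg_left h4 ht'
  have h13 : lam * (t * (k z a + ε / (2 * lam) + lam * t * M)) =
      lam * t * k z a + t * (ε / 2) + lam ^ 2 * t ^ 2 * M := by
    field_simp
  nlinarith

end Values

/-! ### Integrals under `rho` and under convex hulls -/

section Metrization

theorem abs_integral_sub_le_rho {X : Type*} [MeasurableSpace X] {q : ℕ → X → ℝ}
    (hq : ∀ j x, |q j x| ≤ 1) (γ₁ γ₂ : ProbabilityMeasure X) (j : ℕ) :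
    (1 / 2 : ℝ) ^ (j + 1) *
      |(∫ x, q j x ∂(γ₁ : Measure X)) - ∫ x, q j x ∂(γ₂ : Measure X)| ≤ rho q γ₁ γ₂ := by
  have hb : ∀ (γ : ProbabilityMeasure X) j, |∫ x, q j x ∂(γ : Measure X)| ≤ 1 := fun γ j => by
    simpa using norm_integral_le_of_norm_le_const (μ := (γ : Measure X)) (f := q j)
      (Eventually.of_forall (hq j))
  -- Without summability the `tsum` would be `0` by convention and would bound no term.
  have hs : Summable fun j : ℕ => (1 / 2 : ℝ) ^ (j + 1) *
      |(∫ x, q j x ∂(γ₁ : Measure X)) - ∫ x, q j x ∂(γ₂ : Measure X)| := by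
    refine Summable.of_nonneg_of_le (fun j => by positivity) (fun j => ?_)
      (summable_geometric_two)
    have h2 : |(∫ x, q j x ∂(γ₁ : Measure X)) - ∫ x, q j x ∂(γ₂ : Measure X)| ≤ 2 :=
      (abs_sub _ _).trans (by linarith [hb γ₁ j, hb γ₂ j])
    rw [pow_succ]
    nlinarith [show (0 : ℝ) < (1 / 2) ^ j by positivity]
  exact hs.le_tsum j fun i _ => by positivity

/-- Closeness in `rho` implies closeness of the integrals of a given continuous function. -/
theorem exists_forall_rho_lt_abs_integral_sub_le {X : Type*} [MetricSpace X] [CompactSpace X]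
    [MeasurableSpace X] [OpensMeasurableSpace X] {q : ℕ → X → ℝ}
    (hq : IsLipschitzDenseInUnitBall q) {g : X → ℝ} (hg : Continuous g) {ε : ℝ} (hε : 0 < ε) :
    ∃ η > 0, ∀ γ₁ γ₂ : ProbabilityMeasure X, rho q γ₁ γ₂ < η →
      |(∫ x, g x ∂(γ₁ : Measure X)) - ∫ x, g x ∂(γ₂ : Measure X)| ≤ ε := by
  obtain ⟨hqL, hq1, hqd⟩ := hq
  obtain ⟨C₀, hC₀⟩ := isCompact_univ.exists_bound_of_continuousOn hg.continuousOn
  have hC : 0 < max C₀ 1 := by positivity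
  have hgC : ∀ x, ‖g x‖ ≤ max C₀ 1 := fun x => (hC₀ x trivial).trans (le_max_left _ _)
  set C := max C₀ 1
  obtain ⟨j, hj⟩ := hqd (fun x => g x / C) (hg.div_const C)
    (fun x => by rw [abs_div, abs_of_pos hC, div_le_one hC]; exact hgC x) (ε / (4 * C))
    (by positivity)
  -- After division by the weight of `q j`, its two integrals differ by less than `ε / (2 C)`.
  -- Replacing `q j` by `g / C` costs `ε / (4 C)` for each measure, which makes `ε / C` in all.
  refine ⟨(1 / 2) ^ (j + 1) * (ε / (2 * C)), by positivity, fun γ₁ γ₂ h => ?_⟩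
  have h1 := (abs_integral_sub_le_rho hq1 γ₁ γ₂ j).trans_lt h
  have h2 := lt_of_mul_lt_mul_left h1 (by positivity)
  have h3 : ∀ γ : ProbabilityMeasure X, |(∫ x, q j x ∂(γ : Measure X)) -
      (∫ x, g x ∂(γ : Measure X)) / C| ≤ ε / (4 * C) := fun γ => by
    obtain ⟨L, hL⟩ := hqL j
    rw [← integral_div, ← integral_sub (integrable_of_continuous hL.continuous)
      (integrable_of_continuous (hg.div_const C))]
    simpa using norm_integral_le_of_norm_le_const (μ := (γ : Measure X))
      (f := fun x => q j x - g x / C) (Eventually.of_forall fun x => (hj x).le)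
  have h4 := abs_le.1 (h3 γ₁)
  have h5 := abs_le.1 (h3 γ₂)
  have h6 := abs_lt.1 h2
  have h7 : |(∫ x, g x ∂(γ₁ : Measure X)) / C - (∫ x, g x ∂(γ₂ : Measure X)) / C| ≤ ε / C := by
    have e1 : ε / (4 * C) = ε / C / 4 := by field_simp
    have e2 : ε / (2 * C) = ε / C / 2 := by field_simp
    rw [e1] at h4 h5
    rw [e2] at h6
    rw [abs_le]
    constructor <;> linarith [h4.1, h4.2, h5.1, h5.2, h6.1, h6.2]
  rwa [← sub_div, abs_div, abs_of_pos hC, div_le_div_iff_of_pos_right hC] at h7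

theorem exists_rho_lt_of_rhoHausdorff_lt {X : Type*} [MeasurableSpace X] {q : ℕ → X → ℝ}
    {A B : Set (ProbabilityMeasure X)} {η : ℝ} (h : rhoHausdorff q A B < ENNReal.ofReal η)
    {γ : ProbabilityMeasure X} (hγ : γ ∈ B) : ∃ γ' ∈ A, rho q γ γ' < η := by
  have h1 : ⨅ γ' ∈ A, ENNReal.ofReal (rho q γ γ') < ENNReal.ofReal η :=
    lt_of_le_of_lt ((le_iSup₂ (f := fun γ (_ : γ ∈ B) =>
      ⨅ γ' ∈ A, ENNReal.ofReal (rho q γ γ')) γ hγ).trans (le_max_right _ _)) h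
  simp only [iInf_lt_iff] at h1
  obtain ⟨γ', hγ', h2⟩ := h1
  exact ⟨γ', hγ', (ENNReal.ofReal_lt_ofReal_iff_of_nonneg
    (tsum_nonneg fun j => by positivity)).1 h2⟩

/-- An affine bound on integrals passes to the convex hull. -/
theorem integral_le_of_mem_coHull {X : Type*} [MetricSpace X] [CompactSpace X]
    [MeasurableSpace X] [OpensMeasurableSpace X] {S : Set (ProbabilityMeasure X)} {g : X → ℝ}
    (hg : Continuous g) {c : ℝ} (hS : ∀ γ ∈ S, ∫ x, g x ∂(γ : Measure X) ≤ c)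
    {γ : ProbabilityMeasure X} (hγ : γ ∈ coHull S) : ∫ x, g x ∂(γ : Measure X) ≤ c := by
  -- Moving `c` under the integral makes the condition homogeneous, so it defines a convex cone of
  -- finite measures, with no reference to total mass.
  have hconv : Convex ℝ≥0 {μ : FiniteMeasure X | ∫ x, (g x - c) ∂(μ : Measure X) ≤ 0} := by
    intro μ hμ ν hν a b _ _ _
    have hi : ∀ (μ : FiniteMeasure X), Integrable (fun x => g x - c) (μ : Measure X) := fun μ =>
      integrable_of_continuous (hg.sub continuous_const)
    change ∫ x, (g x - c) ∂((a • μ + b • ν : FiniteMeasure X) : Measure X) ≤ 0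
    have hia : Integrable (fun x => g x - c) (a • (μ : Measure X)) := (hi μ).smul_measure_nnreal
    have hib : Integrable (fun x => g x - c) (b • (ν : Measure X)) := (hi ν).smul_measure_nnreal
    rw [FiniteMeasure.toMeasure_add, FiniteMeasure.toMeasure_smul, FiniteMeasure.toMeasure_smul,
      integral_add_measure hia hib, integral_smul_nnreal_measure, integral_smul_nnreal_measure]
    exact add_nonpos (mul_nonpos_of_nonneg_of_nonpos a.2 hμ)
      (mul_nonpos_of_nonneg_of_nonpos b.2 hν)
  have hsub : ∀ γ : ProbabilityMeasure X, ∫ x, (g x - c) ∂(γ : Measure X) =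
      (∫ x, g x ∂(γ : Measure X)) - c := fun γ => by
    rw [integral_sub (integrable_of_continuous hg) (integrable_const _)]
    simp
  have h := convexHull_min (s := ProbabilityMeasure.toFiniteMeasure '' S) (by
    rintro _ ⟨γ', hγ', rfl⟩
    change ∫ x, (g x - c) ∂(γ' : Measure X) ≤ 0
    rw [hsub]
    linarith [hS γ' hγ']) hconv hγ
  change ∫ x, (g x - c) ∂(γ : Measure X) ≤ 0 at h
  rw [hsub] at h
  linarith

end Metrization

/-! ### Occupational measures and the Cesàro value -/

section OccupationalMeasures

set_option linter.unusedSectionVars false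

variable {m : ℕ} {U : Type*} [MetricSpace U] [CompactSpace U] [MeasurableSpace U] [BorelSpace U]
  {f : State m → U → State m} {k : State m → U → ℝ} {K Y : Set (State m)}

theorem integral_occupationalMeasure {T : ℝ} (hT : 0 < T) {γ : ProbabilityMeasure (Y × U)}
    {u : ℝ → U} {y : ℝ → State m} (hu : Measurable u) (hy : ContinuousOn y (Set.Ici 0))
    (hγ : ∀ Q : Set (State m × U), MeasurableSet Q → (γ : Measure (Y × U)) (incl Y ⁻¹' Q) =
        ENNReal.ofReal (1 / T) * ∫⁻ t in Set.Icc 0 T, Q.indicator 1 (y t, u t))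
    {g : State m → U → ℝ} (hg : Continuous (Function.uncurry g)) :
    ∫ p, g (p.1 : State m) p.2 ∂(γ : Measure (Y × U)) =
      (1 / T) * ∫ t in (0 : ℝ)..T, g (y t) (u t) := by
  have : SecondCountableTopology U := EMetric.secondCountable_of_sigmaCompact U
  have hincl : Measurable (incl Y : Y × U → State m × U) :=
    (measurable_subtype_coe.comp measurable_fst).prodMk measurable_snd
  have hyu : AEMeasurable (fun t => (y t, u t)) (volume.restrict (Set.Icc 0 T)) :=
    ((hy.mono Set.Icc_subset_Ici_self).aemeasurable measurableSet_Icc).prodMk hu.aemeasurable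
  -- The defining property of `γ` identifies its image in `ℝ^m × U` with the normalised image of
  -- Lebesgue measure along the process; the formula is then a change of variables.
  have hmap : (γ : Measure (Y × U)).map (incl Y) = ENNReal.ofReal (1 / T) •
      (volume.restrict (Set.Icc 0 T)).map (fun t => (y t, u t)) := by
    ext Q hQ
    rw [Measure.map_apply hincl hQ, hγ Q hQ, Measure.smul_apply, Measure.map_apply_of_aemeasurable
      hyu hQ, smul_eq_mul, ← lintegral_indicator_one₀ (hyu.nullMeasurable hQ)]
    rfl
  have h1 := integral_map (μ := (γ : Measure (Y × U))) hincl.aemeasurable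
    (f := Function.uncurry g) hg.aestronglyMeasurable
  rw [hmap, integral_smul_measure, integral_map hyu hg.aestronglyMeasurable,
    ENNReal.toReal_ofReal (by positivity), integral_Icc_eq_integral_Ioc,
    ← intervalIntegral.integral_of_le hT.le] at h1
  exact h1.symm

/-- The average over `[0, T]` of the optimal `S`-averages along a process is at most the average
cost of the process, up to an error of order `S / T`. -/
theorem integral_cesaroValue_along_le (hf : Continuous (Function.uncurry f))
    (hk : Continuous (Function.uncurry k)) {M S T : ℝ}
    (hM : ∀ z ∈ K, ∀ c, ‖k z c‖ ≤ M) (hv : IsViable f K) (hYK : Y ⊆ K)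
    (hS : 0 < S) (hST : S ≤ T)
    {V : State m → ℝ} (hV : Continuous V)
    (hVK : Set.EqOn (cesaroValue f k K S) V K) {y₀ : State m} {u : ℝ → U} {y : ℝ → State m}
    (h : IsAdmissibleUpTo f Y T y₀ u y) :
    ∫ t in (0 : ℝ)..T, V (y t) ≤ (∫ t in (0 : ℝ)..T, k (y t) (u t)) + 3 * M * S := by
  have hM0 : 0 ≤ M := by
    have := (norm_nonneg (k (y 0) (u 0))).trans (hM _ (hYK (h.2 0 ⟨le_rfl, hS.le.trans hST⟩)) _)
    exact this
  have hTS : 0 ≤ T - S := sub_nonneg.2 hST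
  have hT : 0 ≤ T := hS.le.trans hST
  have hi := fun {a b : ℝ} => intervalIntegrable_along hk h.1.1 h.1.2.1 (a := a) (b := b)
  have hVi := fun {a b : ℝ} => intervalIntegrable_along (F := fun z (_ : U) => V z)
    (hV.comp continuous_fst) h.1.1 h.1.2.1 (a := a) (b := b)
  have hadm : IsAdmissibleUpTo f K T y₀ u y := ⟨h.1, fun t ht => hYK (h.2 t ht)⟩
  set P : ℝ → ℝ := fun t => ∫ s in (0 : ℝ)..t, k (y s) (u s) with hPdef
  have hPc : ContinuousOn P (Set.Icc 0 T) := by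
    have := intervalIntegral.continuousOn_primitive_interval' (a := 0) (hi le_rfl hT)
      (Set.left_mem_uIcc)
    rwa [Set.uIcc_of_le hT] at this
  have hPi : ∀ {a b : ℝ}, 0 ≤ a → a ≤ b → b ≤ T → IntervalIntegrable P volume a b :=
    fun ha hab hb => (hPc.mono (by
      rw [Set.uIcc_of_le hab]; exact Set.Icc_subset_Icc ha hb)).intervalIntegrable
  have hPsub : ∀ {a b : ℝ}, 0 ≤ a → a ≤ b → b ≤ T → |P b - P a| ≤ M * (b - a) := by
    intro a b ha hab hb
    have := intervalIntegral.integral_add_adjacent_intervals (hi le_rfl ha) (hi ha (ha.trans hab))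
    simp only [hPdef]
    rw [← eq_sub_of_add_eq' this]
    exact hadm.abs_integral_le hM ha hab hb
  -- The process restarted at time `t` competes in the problem on `[0, S]`.
  have hVP : ∀ t ∈ Set.Icc 0 (T - S), V (y t) ≤ (1 / S) * (P (t + S) - P t) := by
    intro t ht
    have hsh : IsAdmissibleUpTo f K S (y t) (fun s => u (s + t)) (fun s => y (s + t)) :=
      ⟨h.1.shift hf ht.1, fun s hs => hadm.2 _ ⟨by linarith [hs.1, ht.1], by linarith [hs.2, ht.2]⟩⟩
    have h1 := cesaroValue_le hM hS hsh
    rw [hVK (hadm.2 t ⟨ht.1, by linarith [ht.2]⟩), intervalIntegral.integral_comp_add_right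
      (fun s => k (y s) (u s)), zero_add, add_comm S t] at h1
    rwa [← eq_sub_of_add_eq' (intervalIntegral.integral_add_adjacent_intervals (hi le_rfl ht.1)
      (hi ht.1 (add_nonneg ht.1 hS.le)))]
  have hVM : ∀ t ∈ Set.Icc (T - S) T, V (y t) ≤ M := by
    intro t ht
    have hyt : y t ∈ K := hadm.2 t ⟨hTS.trans ht.1, ht.2⟩
    obtain ⟨u', y', h'⟩ := hv _ hyt
    have h1 := cesaroValue_le hM hS (h'.upTo S)
    have h2 := (abs_le.1 ((h'.upTo S).abs_integral_le hM le_rfl hS.le le_rfl)).2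
    rw [hVK hyt] at h1
    refine h1.trans ?_
    rw [one_div_mul_eq_div, div_le_iff₀ hS]
    linarith
  have hP0 : P 0 = 0 := intervalIntegral.integral_same
  have e1 := intervalIntegral.integral_add_adjacent_intervals (hVi le_rfl hTS) (hVi hTS hT)
  have e2 := intervalIntegral.integral_add_adjacent_intervals (hPi le_rfl hTS (by linarith))
    (hPi hTS (by linarith) le_rfl)
  have e3 := intervalIntegral.integral_add_adjacent_intervals (hPi le_rfl hS.le hST)
    (hPi hS.le hST le_rfl)
  have e4 : ∫ t in (0 : ℝ)..(T - S), P (t + S) = ∫ t in S..T, P t := by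
    simp
  have hPsi : IntervalIntegrable (fun t => P (t + S)) volume 0 (T - S) := by
    simpa using (hPi hS.le hST le_rfl).comp_add_right S
  have i1 : ∫ t in (0 : ℝ)..(T - S), V (y t) ≤
      ∫ t in (0 : ℝ)..(T - S), (1 / S) * (P (t + S) - P t) :=
    intervalIntegral.integral_mono_on hTS (hVi le_rfl hTS)
      ((hPsi.sub (hPi le_rfl hTS (by linarith))).const_mul _) hVP
  rw [intervalIntegral.integral_const_mul, intervalIntegral.integral_sub hPsi
    (hPi le_rfl hTS (by linarith)), e4] at i1
  have i2 : ∫ t in (T - S)..T, V (y t) ≤ ∫ t in (T - S)..T, M :=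
    intervalIntegral.integral_mono_on (by linarith) (hVi hTS hT) (by simp) hVM
  have i3 : ∫ t in (T - S)..T, P t ≤ ∫ t in (T - S)..T, (P T + M * S) :=
    intervalIntegral.integral_mono_on (by linarith) (hPi hTS (by linarith) le_rfl) (by simp)
      fun t ht => by
        have := (abs_le.1 (hPsub (hTS.trans ht.1) ht.2 le_rfl)).1
        nlinarith [ht.1]
  have i4 : ∫ t in (0 : ℝ)..S, (-(M * S)) ≤ ∫ t in (0 : ℝ)..S, P t :=
    intervalIntegral.integral_mono_on hS.le (by simp) (hPi le_rfl hS.le hST)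
      fun t ht => by
        have := (abs_le.1 (hPsub le_rfl ht.1 (ht.2.trans hST))).1
        nlinarith [ht.2]
  rw [intervalIntegral.integral_const, smul_eq_mul, sub_sub_cancel] at i2 i3
  rw [intervalIntegral.integral_const, smul_eq_mul, sub_zero] at i4
  -- The integrals of `P` cancel except over the end windows `[T - S, T]` and `[0, S]`, where `P` is
  -- at most `P T + M S` and at least `-M S`. The values of `V` on the last window add the third `M
  -- S`.
  have i5 : (1 / S) * ((∫ t in S..T, P t) - ∫ t in (0 : ℝ)..(T - S), P t) ≤ P T + 2 * M * S := by
    rw [one_div_mul_eq_div, div_le_iff₀ hS]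
    linarith
  linarith

/-- Every invariant measure is a limit of averages of processes, so that it cannot do better than
the optimal value of the time-averaged problem. -/
theorem integral_cesaroValue_le_of_mem_invariantMeasures (hf : Continuous (Function.uncurry f))
    (hk : Continuous (Function.uncurry k)) (hY : IsCompact Y) {q : ℕ → Y × U → ℝ}
    (hq : IsLipschitzDenseInUnitBall q)
    (hA5 : Tendsto (fun T : ℝ => rhoHausdorff q (coHull (occupationalMeasures f Y T))
      (invariantMeasures f Y)) atTop (𝓝 0)) {M S : ℝ}
    (hM : ∀ z ∈ K, ∀ c, ‖k z c‖ ≤ M) (hv : IsViable f K) (hYK : Y ⊆ K) (hS : 0 < S)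
    {V : State m → ℝ} (hV : Continuous V) (hVK : Set.EqOn (cesaroValue f k K S) V K)
    {γ : ProbabilityMeasure (Y × U)} (hγ : γ ∈ invariantMeasures f Y) :
    ∫ p, V (p.1 : State m) ∂(γ : Measure (Y × U)) ≤
      ∫ p, k (p.1 : State m) p.2 ∂(γ : Measure (Y × U)) := by
  have : CompactSpace Y := isCompact_iff_compactSpace.1 hY
  have : SecondCountableTopology U := EMetric.secondCountable_of_sigmaCompact U
  have hg : Continuous (Function.uncurry fun (z : State m) a => V z - k z a) :=
    (hV.comp continuous_fst).sub hk
  have hgY : Continuous fun p : Y × U => V p.1 - k p.1 p.2 :=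
    hg.comp (by fun_prop : Continuous fun p : Y × U => ((p.1 : State m), p.2))
  suffices h : ∫ p : Y × U, (V p.1 - k p.1 p.2) ∂(γ : Measure (Y × U)) ≤ 0 by
    rw [integral_sub (integrable_on_prod hY (g := fun z _ => V z) (hV.comp continuous_fst))
      (integrable_on_prod hY hk)] at h
    linarith
  refine le_of_forall_pos_le_add fun ε hε => ?_
  obtain ⟨η, hη, hclose⟩ := exists_forall_rho_lt_abs_integral_sub_le hq hgY (half_pos hε)
  -- The window `S` stays fixed while `T` grows: far enough for `rho`-closeness to `γ`, and for `3 M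
  -- S / T ≤ ε / 2`.
  obtain ⟨T, hTη, hST, hTε⟩ := ((hA5.eventually_lt_const (ENNReal.ofReal_pos.2 hη)).and
    ((eventually_ge_atTop S).and (eventually_ge_atTop (3 * M * S / (ε / 2))))).exists
  have hT : 0 < T := hS.trans_le hST
  obtain ⟨γ', hγ', hρ⟩ := exists_rho_lt_of_rhoHausdorff_lt hTη hγ
  have h1 := (abs_le.1 (hclose γ γ' hρ)).2
  have h2 : ∫ p : Y × U, (V p.1 - k p.1 p.2) ∂(γ' : Measure (Y × U)) ≤ ε / 2 := by
    refine integral_le_of_mem_coHull hgY ?_ hγ'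
    rintro γ'' ⟨y₀, -, u, y, h, hQ⟩
    rw [integral_occupationalMeasure hT h.1.1 h.1.2.1 hQ (g := fun z a => V z - k z a) hg,
      intervalIntegral.integral_sub (intervalIntegrable_along (F := fun z (_ : U) => V z)
        (hV.comp continuous_fst) h.1.1 h.1.2.1 le_rfl hT.le)
        (intervalIntegrable_along hk h.1.1 h.1.2.1 le_rfl hT.le), one_div_mul_eq_div,
      div_le_iff₀ hT]
    have h3 := integral_cesaroValue_along_le hf hk hM hv hYK hS hST hV hVK h
    rw [div_le_iff₀ (half_pos hε)] at hTε
    linarith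
  linarith

end OccupationalMeasures

/-! ### Passage to the limit in the relaxation -/

section Limits

/-- A bound on the values of the relaxed problems passes to the upper limit of the values. -/
theorem limsup_le_of_tendsto_abs_sub {ι : Type*} {F : Filter ι} {v : ι → ℝ} {w : ℝ → ι → ℝ}
    {a δ₁ : ℝ} (hδ₁ : 0 < δ₁)
    (hvw : Tendsto (fun p : ι × ℝ => |v p.1 - w p.2 p.1|) (F ×ˢ 𝓝[>] 0) (𝓝 0))
    (hw : ∀ ε > 0, ∀ᶠ i in F, ∀ δ ∈ Set.Ioo 0 δ₁, w δ i ≤ a + ε) :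
    limsup (fun i => (v i : EReal)) F ≤ a := by
  have hv : ∀ ε > 0, ∀ᶠ i in F, v i ≤ a + ε := by
    intro ε hε
    -- For each late index `i` a suitable `δ` is chosen depending on `i`; this is allowed because
    -- `hw` is uniform in `δ`.
    filter_upwards [(hvw.eventually_lt_const (half_pos hε)).curry, hw _ (half_pos hε)] with i h1 h2
    obtain ⟨δ, h3, hδ⟩ := (h1.and (Ioo_mem_nhdsGT hδ₁)).exists
    linarith [h2 δ hδ, le_abs_self (v i - w δ i)]
  refine le_of_forall_gt fun b hb => ?_
  obtain ⟨c, hac, hcb⟩ := EReal.lt_iff_exists_real_btwn.1 hb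
  refine lt_of_le_of_lt (limsup_le_of_le (h := ?_)) hcb
  filter_upwards [hv (c - a) (sub_pos.2 (EReal.coe_lt_coe_iff.1 hac))] with i hi
  exact EReal.coe_le_coe_iff.2 (by linarith)

end Limits

/-! ### Closed neighbourhoods of `Y` -/

section Enlargement

variable {m : ℕ} {Y : Set (State m)}

theorem mem_enlarge_of_dist_le {δ : ℝ} {y z : State m} (hy : y ∈ Y) (h : dist z y ≤ δ) :
    z ∈ enlarge Y δ :=
  ⟨y, hy, z - y, by simpa [dist_eq_norm] using h, by simp⟩

theorem isCompact_enlarge (hY : IsCompact Y) (δ : ℝ) : IsCompact (enlarge Y δ) :=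
  hY.add (isCompact_closedBall 0 δ)

theorem enlarge_mono {δ δ' : ℝ} (h : δ ≤ δ') : enlarge Y δ ⊆ enlarge Y δ' :=
  Set.add_subset_add_left (Metric.closedBall_subset_closedBall h)

end Enlargement

end LongRunControl

/-! ### The two upper bounds -/

theorem theorem3p3 {m : ℕ} {U : Type*} [MetricSpace U] [CompactSpace U] [MeasurableSpace U]
    [BorelSpace U]
    (f : LongRunControl.State m → U → LongRunControl.State m)
    (hf : Continuous (Function.uncurry f))
    (hfL : ∃ L : ℝ≥0, ∀ u : U, LipschitzWith L (fun y => f y u))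
    (k : LongRunControl.State m → U → ℝ) (hk : Continuous (Function.uncurry k))
    (Y : Set (LongRunControl.State m)) (hYne : Y.Nonempty) (hYc : IsCompact Y)
    (hYi : Y = closure (interior Y))
    (hviable : LongRunControl.IsViable f Y)
    (q : ℕ → Y × U → ℝ) (hq : LongRunControl.IsLipschitzDenseInUnitBall q)
    (δ₀ : ℝ) (hδ₀ : 0 < δ₀)
    -- viability of the enlarged sets
    (hA1 : ∀ δ ∈ Set.Ioo 0 δ₀, LongRunControl.IsViable f (LongRunControl.enlarge Y δ)) :
    -- Cesaro means
    ((∀ δ ∈ Set.Ioo 0 δ₀, ∀ T : ℝ, 0 < T → ∃ L : ℝ≥0, LipschitzOnWith L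
          (LongRunControl.cesaroValue f k (LongRunControl.enlarge Y δ) T)
          (LongRunControl.enlarge Y δ)) →
      (∀ y₀ ∈ Y, Tendsto (fun p : ℝ × ℝ => |LongRunControl.cesaroValue f k Y p.1 y₀ -
          LongRunControl.cesaroValue f k (LongRunControl.enlarge Y p.2) p.1 y₀|)
          (atTop ×ˢ 𝓝[>] 0) (𝓝 0)) →
      Tendsto (fun T : ℝ => LongRunControl.rhoHausdorff q
          (LongRunControl.coHull (LongRunControl.occupationalMeasures f Y T))
          (LongRunControl.invariantMeasures f Y)) atTop (𝓝 0) →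
      ∀ y₀ ∈ Y, limsup (fun T : ℝ => (LongRunControl.cesaroValue f k Y T y₀ : EReal)) atTop ≤
        LongRunControl.lpValue f k Y y₀) ∧
    -- Abel means
    ((∀ δ ∈ Set.Ioo 0 δ₀, ∀ lam : ℝ, 0 < lam → ∃ L : ℝ≥0, LipschitzOnWith L
          (LongRunControl.abelValue f k (LongRunControl.enlarge Y δ) lam)
          (LongRunControl.enlarge Y δ)) →
      (∀ y₀ ∈ Y, Tendsto (fun p : ℝ × ℝ => |LongRunControl.abelValue f k Y p.1 y₀ -
          LongRunControl.abelValue f k (LongRunControl.enlarge Y p.2) p.1 y₀|)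
          (𝓝[>] 0 ×ˢ 𝓝[>] 0) (𝓝 0)) →
      Tendsto (fun lam : ℝ => LongRunControl.rhoHausdorff q
          (LongRunControl.coHull (LongRunControl.discountedOccupationalMeasures f Y lam))
          (LongRunControl.invariantMeasures f Y)) (𝓝[>] 0) (𝓝 0) →
      ∀ y₀ ∈ Y, limsup (fun lam : ℝ => (LongRunControl.abelValue f k Y lam y₀ : EReal)) (𝓝[>] 0) ≤
        LongRunControl.lpValue f k Y y₀) := by
  obtain ⟨Lf, hfL⟩ := hfL
  -- One bound on `k` serves all `δ < δ₀ / 2`, so the error terms do not depend on `δ`.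
  obtain ⟨M, hM0, hM⟩ := LongRunControl.exists_norm_le_of_isCompact hk
    (LongRunControl.isCompact_enlarge hYc (δ₀ / 2))
  have hMδ : ∀ δ ∈ Set.Ioo 0 (δ₀ / 2), ∀ z ∈ LongRunControl.enlarge Y δ, ∀ a, ‖k z a‖ ≤ M :=
    fun δ hδ z hz => hM z (LongRunControl.enlarge_mono hδ.2.le hz)
  have hδ' : ∀ δ ∈ Set.Ioo 0 (δ₀ / 2), δ ∈ Set.Ioo 0 δ₀ := fun δ hδ => ⟨hδ.1, by
    linarith [hδ.2]⟩
  -- Half of `δ` is room for mollification, the other half for the short trajectories.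
  have hYδ : ∀ δ : ℝ, ∀ y ∈ Y, ∀ w, dist w y ≤ 2 * (δ / 2) → w ∈ LongRunControl.enlarge Y δ :=
    fun δ y hy w hw => LongRunControl.mem_enlarge_of_dist_le hy (by linarith)
  have hsub : ∀ δ ∈ Set.Ioo 0 (δ₀ / 2), Y ⊆ LongRunControl.enlarge Y δ := fun δ hδ y hy =>
    LongRunControl.mem_enlarge_of_dist_le hy (by simpa using hδ.1.le)
  refine ⟨fun hA2 hA4 hA5 y₀ hy₀ => le_iInf₂ fun π hπ => ?_,
    fun hA3 hA6 _ y₀ hy₀ => le_iInf₂ fun π hπ => ?_⟩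
  · refine LongRunControl.limsup_le_of_tendsto_abs_sub (half_pos hδ₀)
      (w := fun δ T => LongRunControl.cesaroValue f k (LongRunControl.enlarge Y δ) T y₀)
      (hA4 y₀ hy₀) fun ε hε => ?_
    set ν := (π.2 : Measure (Y × U)).real Set.univ with hν
    filter_upwards [eventually_gt_atTop 0, eventually_ge_atTop (2 * M * ν / ε)] with T hT hTε δ hδ
    obtain ⟨L, hL⟩ := hA2 δ (hδ' δ hδ) T hT
    obtain ⟨V, hV, hVK⟩ := hL.extend_real
    have h1 := (LongRunControl.isSubsolution_cesaroValue hf hk hfL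
      (LongRunControl.isCompact_enlarge hYc δ) (hMδ δ hδ) (hA1 δ (hδ' δ hδ)) hT (half_pos hδ.1)
      (hYδ δ) hV hVK).sub_integral_le hV hf hfL continuous_const hYc (half_pos hδ.1) hπ
    -- Here `T` plays the role of the fixed window `S`; the longer horizon is internal to the lemma.
    have h2 := LongRunControl.integral_cesaroValue_le_of_mem_invariantMeasures hf hk hYc hq hA5
      (hMδ δ hδ) (hA1 δ (hδ' δ hδ)) (hsub δ hδ) hT hV.continuous hVK hπ.1
    rw [integral_const, smul_eq_mul, ← hν] at h1
    rw [hVK (hsub δ hδ hy₀)]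
    have h3 : ν * (2 * M / T) ≤ ε := by
      rw [div_le_iff₀ hε] at hTε
      rw [mul_div_assoc', div_le_iff₀ hT]
      linarith
    linarith
  · refine LongRunControl.limsup_le_of_tendsto_abs_sub (half_pos hδ₀)
      (w := fun δ lam => LongRunControl.abelValue f k (LongRunControl.enlarge Y δ) lam y₀)
      (hA6 y₀ hy₀) fun ε hε => ?_
    set ν := (π.2 : Measure (Y × U)).real Set.univ with hν
    filter_upwards [self_mem_nhdsWithin, LongRunControl.eventually_mul_le (2 * M * ν) hε] with
      lam hlam hlamε δ hδ
    have hlam : 0 < lam := hlam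
    obtain ⟨L, hL⟩ := hA3 δ (hδ' δ hδ) lam hlam
    obtain ⟨V, hV, hVK⟩ := hL.extend_real
    have hVc : Continuous (Function.uncurry fun (z : LongRunControl.State m) (_ : U) => V z) :=
      hV.continuous.comp continuous_fst
    have hg : Continuous (Function.uncurry fun z a => lam * (k z a - V z)) :=
      continuous_const.mul (hk.sub hVc)
    have hsubs := LongRunControl.isSubsolution_abelValue hf hk hfL
      (LongRunControl.isCompact_enlarge hYc δ) (hMδ δ hδ) (hA1 δ (hδ' δ hδ)) hlam (half_pos hδ.1)
      (hYδ δ) hV hVK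
    have h1 := hsubs.sub_integral_le hV hf hfL hg hYc (half_pos hδ.1) hπ
    have h2 := hsubs.integral_nonneg hV hf hfL hg hYc (half_pos hδ.1) hπ.1
    rw [integral_const_mul, integral_sub (LongRunControl.integrable_on_prod hYc hk)
      (LongRunControl.integrable_on_prod hYc hVc)] at h2
    have h3 := nonneg_of_mul_nonneg_right h2 hlam
    -- On `Y` both `k` and `V` are bounded by `M`, so `∫ g dξ` is at most `2 M λ` times the mass of
    -- `ξ`.
    have h4 : ∫ p : Y × U, lam * (k p.1 p.2 - V p.1) ∂(π.2 : Measure (Y × U)) ≤ lam * (2 * M) * ν := by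
      have := norm_integral_le_of_norm_le_const (μ := (π.2 : Measure (Y × U)))
        (f := fun p : Y × U => lam * (k p.1 p.2 - V p.1)) (C := lam * (2 * M))
        (Eventually.of_forall fun p => by
          have hp := hsub δ hδ p.1.2
          have hb := LongRunControl.abs_abelValue_le (k := k) (hA1 δ (hδ' δ hδ)) (hMδ δ hδ) hlam hp
          rw [hVK hp] at hb
          rw [norm_mul, Real.norm_of_nonneg hlam.le]
          refine mul_le_mul_of_nonneg_left ((norm_sub_le _ _).trans ?_) hlam.le
          rw [Real.norm_eq_abs (V _)]
          linarith [hMδ δ hδ p.1 hp p.2])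
      exact (le_abs_self _).trans this
    rw [hVK (hsub δ hδ hy₀)]
    linarith
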